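/- Let $R=R_1\times\cdots\times R_t$ be a finite Frobenius ring with $R_i=R_{i,1}\times\cdots\times R_{i,n_i}$, $n_i\ge 1$, where each $R_{i,j}$ is a finite (not necessarily commutative) local ring, $|R_{i,j}/\mathrm{rad}(R_{i,j})|=|\mathrm{soc}(R_{i,j})|=q_i$ for all $j$, and $q_1,\dots,q_t$ are distinct (here $\mathrm{rad}$ is the Jacobson radical and $\mathrm{soc}$ the socle; a finite ring $R$ is Frobenius if $\mathrm{soc}({}_RR)\cong R/\mathrm{rad}(R)$ as left $R$-modules). Definitions. The normalized homogeneous weight on $R$ is the unique function $\omega:R\to\mathbb Q$ with $\omega(0)=0$, $\omega(x)=\omega(y)$ whenever $Rx=Ry$, and $\sum_{y\in Rx}\omega(y)=|Rx|$ for all $x\neq0$; $\mathcal P_{\rm hom}$ is the partition of $R$ given by $x\sim y\Leftrightarrow\omega(x)=\omega(y)$. For $a_i\in R_i$ put $\mathrm{wt}(a_i)=|\{j: a_{i,j}\ne0\}|$; the Hamming partition of $R_i$ is given by $a_i\sim b_i\Leftrightarrow \mathrm{wt}(a_i)=\mathrm{wt}(b_i)$. The partition $\mathcal H'$ of $R$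 has the blocks $R\setminus\mathrm{soc}(R)$ (omitted if empty) and $\{(a_1,\dots,a_t)\in\mathrm{soc}(R): \mathrm{wt}(a_i)=m_i\ \forall i\}$ for $0\le m_i\le n_i$. For a partition $\mathcal P$ of a finite abelian group $G$, the dual partition $\widehat{\mathcal P}$ of the character group $\widehat G$ is given by $\chi\sim\chi'\Leftrightarrow\sum_{g\in P}\chi(g)=\sum_{g\in P}\chi'(g)$ for all blocks $P$ of $\mathcal P$; $\mathcal P$ is reflexive if $\widehat{\widehat{\mathcal P}}=\mathcal P$ under the canonical identification $G\cong\widehat{\widehat G}$. A character $\chi$ of $(R,+)$ is generating if $v\mapsto\chi(\,\cdot\,v)$ and $v\mapsto\chi(v\,\cdot\,)$ are bijections $R\to\widehat R$; the left and right $\chi$-dual $\widehat{\mathcal P}^{[\chi,l]}$, $\widehat{\mathcal P}^{[\chi,r]}$ of a partition $\mathcal P$ of $R$ are the preimages of $\widehat{\mathcal P}$ under these two maps. The list $[(q_1,n_1),\dots,(q_t,n_t)]$ is separating if for all distinct $m,\ell\in\prod_{i}\{0,\dots,n_i\}$ one has $\prod_i(q_i-1)^{m_i}\ne\prod_i(q_i-1)^{\ell_i}$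 or $\sum_i m_i\not\equiv\sum_i\ell_i \pmod 2$. Theorem. Suppose that $[(q_1,n_1),\dots,(q_t,n_t)]$ is separating. Then: 1. $\mathcal P_{\rm hom}=\mathcal H'$. 2. $\mathcal P_{\rm hom}$ is reflexive. Generating characters of $R$ exist, and there is a partition $\widehat{\mathcal H'}$ of $R$ such that for every generating character $\chi$ both the left and the right $\chi$-dual of $\mathcal H'$, as well as both the left and the right $\chi$-dual of $\mathcal P_{\rm hom}$, are equal to $\widehat{\mathcal H'}$. 3. $R=\mathrm{soc}(R)$ if and only if $R$ is semisimple, and in that case $\mathcal P_{\rm hom}$ is the product of the Hamming partitions of $R_1,\dots,R_t$ and is self-dual, that is, $\widehat{\mathcal P_{\rm hom}}^{[\chi,l]}=\widehat{\mathcal P_{\rm hom}}^{[\chi,r]}=\mathcal P_{\rm hom}$ for every generating character $\chi$. -/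

import Mathlib

namespace HomogPart

/-! ### Socle, Frobenius rings, generating characters -/

/-- The socle of the left module `R` over the ring `R`: the sum of all simple left ideals. -/
def socle (R : Type*) [Ring R] : Ideal R :=
  sSup {I : Ideal R | IsSimpleModule R I}

/-- `R` is Frobenius: the left modules `soc(R)` and `R / rad(R)` are isomorphic.
(For finite rings; `Ring.jacobson R` is the Jacobson radical.) -/
def IsFrobenius (R : Type*) [Ring R] : Prop :=
  Nonempty (socle R ≃ₗ[R] (R ⧸ Ring.jacobson R))

/-- The map `v ↦ (w ↦ χ (w * v))`, i.e. `v ↦ v · χ`. -/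
def leftMap {R : Type*} [Ring R] (χ : AddChar R ℂ) (v : R) : AddChar R ℂ :=
  χ.compAddMonoidHom (AddMonoidHom.mulRight v)

/-- The map `v ↦ (w ↦ χ (v * w))`, i.e. `v ↦ χ · v`. -/
def rightMap {R : Type*} [Ring R] (χ : AddChar R ℂ) (v : R) : AddChar R ℂ :=
  χ.compAddMonoidHom (AddMonoidHom.mulLeft v)

/-- A character `χ` of `(R, +)` is generating if `r ↦ r · χ` and `r ↦ χ · r` are bijections
from `R` onto its character group. -/
def IsGenerating {R : Type*} [Ring R] (χ : AddChar R ℂ) : Prop :=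
  Function.Bijective (leftMap χ) ∧ Function.Bijective (rightMap χ)

/-! ### Partitions and their duals

A partition of a set is given by its equivalence relation; the blocks are `Setoid.classes`. -/

/-- The dual partition, on the character group of the finite abelian group `G`: two characters
are equivalent if they have the same sum over each block of `P`. -/
def dualPartition {G : Type*} [AddCommGroup G] [Finite G] (P : Setoid G) :
    Setoid (AddChar G ℂ) where
  r χ χ' := ∀ B ∈ P.classes, ∑ᶠ g ∈ B, χ g = ∑ᶠ g ∈ B, χ' g
  iseqv :=
    { refl := fun _ _ _ => rfl
      symm := fun h B hB => (h B hB).symm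
      trans := fun h h' B hB => (h B hB).trans (h' B hB) }

/-- `P` is reflexive if it is its own bidual, `G` being identified with its double character
group by evaluation. -/
def IsReflexive {G : Type*} [AddCommGroup G] [Finite G] (P : Setoid G) : Prop :=
  Setoid.comap (AddChar.doubleDualEmb : G →+ AddChar (AddChar G ℂ) ℂ)
    (dualPartition (dualPartition P)) = P

/-- The left `χ`-dual: `v ∼ v'` iff `∑_{w ∈ B} χ (w * v) = ∑_{w ∈ B} χ (w * v')` for all
blocks `B`. -/
def leftDual {R : Type*} [Ring R] [Finite R] (χ : AddChar R ℂ) (P : Setoid R) : Setoid R :=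
  Setoid.comap (leftMap χ) (dualPartition P)

/-- The right `χ`-dual: `v ∼ v'` iff `∑_{w ∈ B} χ (v * w) = ∑_{w ∈ B} χ (v' * w)` for all
blocks `B`. -/
def rightDual {R : Type*} [Ring R] [Finite R] (χ : AddChar R ℂ) (P : Setoid R) : Setoid R :=
  Setoid.comap (rightMap χ) (dualPartition P)

/-- The product partition: its blocks are the products of blocks. -/
def prodPartition {ι : Type*} {A : ι → Type*} (P : ∀ i, Setoid (A i)) : Setoid (∀ i, A i) where
  r a b := ∀ i, P i (a i) (b i)
  iseqv :=
    { refl := fun a i => (P i).refl (a i)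
      symm := fun h i => (P i).symm (h i)
      trans := fun h h' i => (P i).trans (h i) (h' i) }

open Classical in
/-- The Hamming weight `|{j | x j ≠ 0}|`. -/
noncomputable def wt {n : ℕ} {A : Fin n → Type*} [∀ j, Zero (A j)] (x : ∀ j, A j) : ℕ :=
  hammingNorm x

/-- The partition of a product `A 0 × ⋯ × A (n-1)` induced by the Hamming weight. -/
noncomputable def hammingPartition {n : ℕ} (A : Fin n → Type*) [∀ j, Zero (A j)] :
    Setoid (∀ j, A j) :=
  Setoid.ker wt

/-- The extension of a partition of a subset `S` of `X` by the single block `X \ S`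
(which is missing if `S = X`). -/
def extendPartition {X : Type*} (S : Set X) (P : Setoid S) : Setoid X where
  r x y := (x ∉ S ∧ y ∉ S) ∨ ∃ (hx : x ∈ S) (hy : y ∈ S), P ⟨x, hx⟩ ⟨y, hy⟩
  iseqv :=
    { refl := fun x => by
        by_cases hx : x ∈ S
        · exact Or.inr ⟨hx, hx, P.refl _⟩
        · exact Or.inl ⟨hx, hx⟩
      symm := by
        rintro x y (⟨hx, hy⟩ | ⟨hx, hy, h⟩)
        · exact Or.inl ⟨hy, hx⟩
        · exact Or.inr ⟨hy, hx, P.symm h⟩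
      trans := by
        rintro x y z (⟨hx, hy⟩ | ⟨hx, hy, h⟩) (⟨hy', hz⟩ | ⟨hy', hz, h'⟩)
        · exact Or.inl ⟨hx, hz⟩
        · exact absurd hy' hy
        · exact absurd hy hy'
        · exact Or.inr ⟨hx, hz, P.trans h h'⟩ }

/-- The partition `H'` of `R = ∏ i, ∏ j, R i j`: the product over `i` of the Hamming partitions,
restricted to `soc(R)`, together with the block `R \ soc(R)`. -/
noncomputable def hammingSoclePartition {t : ℕ} {n : Fin t → ℕ}
    (R : ∀ i : Fin t, Fin (n i) → Type*) [∀ i j, Ring (R i j)] : Setoid (∀ i j, R i j) :=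
  extendPartition (socle (∀ i j, R i j) : Set (∀ i j, R i j))
    (Setoid.comap Subtype.val (prodPartition fun i => hammingPartition (R i)))

/-! ### The homogeneous weight -/

/-- `ω` is a (left) homogeneous weight on `R` with average value `γ`. -/
structure IsHomogeneousWeight {R : Type*} [Ring R] (γ : ℚ) (ω : R → ℚ) : Prop where
  map_zero : ω 0 = 0
  eq_of_span_eq : ∀ x y : R, Ideal.span {x} = Ideal.span {y} → ω x = ω y
  average : ∀ x : R, x ≠ 0 →
    ∑ᶠ y ∈ (Ideal.span {x} : Set R), ω y = γ * (Nat.card (Ideal.span {x} : Ideal R) : ℚ)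

theorem span_lt_or_eq {R : Type*} [Ring R] {I : Ideal R} {y : R} :
    y ∈ I ↔ Ideal.span {y} < I ∨ Ideal.span {y} = I := by
  rw [← le_iff_lt_or_eq, Ideal.span_singleton_le_iff_mem]

open Classical in
theorem finsum_ideal {R : Type*} [Ring R] [Fintype R] (I : Ideal R) (ω : R → ℚ) :
    ∑ᶠ y ∈ (I : Set R), ω y =
      (∑ y : R, if Ideal.span {y} < I then ω y else 0) +
        ∑ y : R, if Ideal.span {y} = I then ω y else 0 := by
  rw [← Finset.sum_add_distrib, finsum_mem_def, finsum_eq_sum_of_fintype]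
  refine Finset.sum_congr rfl fun y _ => ?_
  by_cases h1 : Ideal.span {y} < I
  · have h2 : y ∈ I := span_lt_or_eq.2 (Or.inl h1)
    simp [h1, h1.ne, h2]
  · by_cases h2 : Ideal.span {y} = I
    · have h3 : y ∈ I := span_lt_or_eq.2 (Or.inr h2)
      simp [h2, h3]
    · have h3 : y ∉ I := fun h => (span_lt_or_eq.1 h).elim h1 h2
      simp [h1, h2, h3]

/-- A finite ring has exactly one homogeneous weight with a given average value. -/
theorem existsUnique_isHomogeneousWeight (R : Type*) [Ring R] [Finite R] (γ : ℚ) :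
    ∃! ω : R → ℚ, IsHomogeneousWeight γ ω := by
  classical
  have : Fintype R := Fintype.ofFinite R
  have hgen : ∀ x : R,
      ((Finset.univ.filter fun y : R => Ideal.span {y} = Ideal.span {x}).card : ℚ) ≠ 0 := by
    intro x
    exact_mod_cast (Finset.card_pos.2 ⟨x, by simp⟩).ne'
  have wf : WellFounded ((· < ·) : Ideal R → Ideal R → Prop) := wellFounded_lt
  refine existsUnique_of_exists_of_unique ?_ ?_
  · obtain ⟨f, hf⟩ : ∃ f : Ideal R → ℚ, ∀ I, f I = if I = ⊥ then 0 else
        (γ * (Nat.card I : ℚ) - ∑ y : R, if Ideal.span {y} < I then f (Ideal.span {y}) else 0) /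
          ((Finset.univ.filter fun y : R => Ideal.span {y} = I).card : ℚ) := by
      refine ⟨wf.fix fun I g => if I = ⊥ then 0 else
        (γ * (Nat.card I : ℚ) -
          ∑ y : R, if h : Ideal.span {y} < I then g (Ideal.span {y}) h else 0) /
          ((Finset.univ.filter fun y : R => Ideal.span {y} = I).card : ℚ), fun I => ?_⟩
      rw [wf.fix_eq]
      simp only [dite_eq_ite]
    refine ⟨fun x => f (Ideal.span {x}), ?_, ?_, ?_⟩
    · rw [hf]; simp
    · intro x y h
      simp only [h]
    · intro x hx
      have h0 : (Ideal.span {x} : Ideal R) ≠ ⊥ := by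
        rwa [Ne, Ideal.span_singleton_eq_bot]
      have h2 : (∑ y : R, if Ideal.span {y} = (Ideal.span {x} : Ideal R)
          then f (Ideal.span {y}) else 0) =
          ((Finset.univ.filter fun y : R => Ideal.span {y} = Ideal.span {x}).card : ℚ) *
            f (Ideal.span {x}) := by
        rw [← Finset.sum_filter, Finset.sum_congr rfl (g := fun _ => f (Ideal.span {x})),
          Finset.sum_const, nsmul_eq_mul]
        intro y hy
        rw [(Finset.mem_filter.1 hy).2]
      rw [finsum_ideal, h2, hf (Ideal.span {x}), if_neg h0, mul_div_cancel₀ _ (hgen x)]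
      ring
  · intro ω ω' h h'
    have key : ∀ I : Ideal R, ∀ x : R, Ideal.span {x} = I → ω x = ω' x := by
      intro I
      induction I using wf.induction with
      | _ I ih =>
        intro x hxI
        by_cases hx : x = 0
        · rw [hx, h.map_zero, h'.map_zero]
        have e := (h.average x hx).trans (h'.average x hx).symm
        have hc : ∀ w : R → ℚ, IsHomogeneousWeight γ w →
            (∑ y : R, if Ideal.span {y} = (Ideal.span {x} : Ideal R) then w y else 0) =
            ((Finset.univ.filter fun y : R => Ideal.span {y} = Ideal.span {x}).card : ℚ) *
              w x := by
          intro w hw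
          rw [← Finset.sum_filter, Finset.sum_congr rfl (g := fun _ => w x),
            Finset.sum_const, nsmul_eq_mul]
          intro y hy
          exact hw.eq_of_span_eq _ _ (Finset.mem_filter.1 hy).2
        have hl : (∑ y : R, if Ideal.span {y} < (Ideal.span {x} : Ideal R) then ω y else 0) =
            ∑ y : R, if Ideal.span {y} < (Ideal.span {x} : Ideal R) then ω' y else 0 := by
          refine Finset.sum_congr rfl fun y _ => ?_
          split_ifs with hy
          · exact ih _ (hxI ▸ hy) y rfl
          · rfl
        rw [finsum_ideal, finsum_ideal, hc ω h, hc ω' h', hl] at e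
        exact mul_left_cancel₀ (hgen x) (add_left_cancel e)
    exact funext fun x => key _ x rfl

/-- The normalized homogeneous weight: the unique homogeneous weight with average value `1`. -/
noncomputable def homWeight (R : Type*) [Ring R] [Finite R] : R → ℚ :=
  (existsUnique_isHomogeneousWeight R 1).choose

theorem homWeight_spec (R : Type*) [Ring R] [Finite R] :
    IsHomogeneousWeight 1 (homWeight R) :=
  (existsUnique_isHomogeneousWeight R 1).choose_spec.1

/-- The partition `P_hom` of `R` induced by the homogeneous weight. -/
noncomputable def homPartition (R : Type*) [Ring R] [Finite R] : Setoid R :=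
  Setoid.ker (homWeight R)

/-! ### Separating lists -/

/-- The list `[(q_1,n_1),…,(q_t,n_t)]` is separating. -/
def IsSeparating {t : ℕ} (q n : Fin t → ℕ) : Prop :=
  ∀ m l : Fin t → ℕ, (∀ i, m i ≤ n i) → (∀ i, l i ≤ n i) → m ≠ l →
    ∏ i, ((q i : ℤ) - 1) ^ m i ≠ ∏ i, ((q i : ℤ) - 1) ^ l i ∨
      ¬ (∑ i, m i ≡ ∑ i, l i [MOD 2])

end HomogPart

/-! In each local factor the equality |soc| = |R/rad| makes the socle a simple left ideal contained
in every nonzero left ideal (`socle_le_span`). Hence the function with value 1 at 0, -1/(q-1) on the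
rest of the socle and 0 elsewhere sums to 0 over every nonzero principal left ideal, and 1 minus the
product of these functions over all factors satisfies the axioms of the homogeneous weight
(`homWeight_pi_pi`). The product vanishes exactly off the socle; at a socle element it is ∏
(-1/(q_i-1))^wt(a_i), whose absolute value and sign encode the two quantities in the separating
condition. So the weight determines the wt(a_i), and P_hom = H' (`homPartition_eq`).

For the duality, a generating character splits into nondegenerate pairings χ(wv) of the factors,
under which socle and radical annihilate each other and have complementary orders. The candidate
dual of H' counts, for each i, the coordinates outside the radical, and isolates 0. Block sums
factor over the coordinates through a generating function in which each coordinate contributes one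
of two linear polynomials (`sum_prod_card_eq`), so each of the two partitions has block sums
constant on the blocks of the other. Dualizing is monotone and a bidual refines the original
partition, so these two inclusions already force each partition to be the dual of the other
(`IsDualPairing.kernelDual_eq`); reflexivity comes with it. The candidate mentions neither χ nor a
side. If R is semisimple, the radicals vanish and both partitions are the product of the Hamming
partitions. -/

namespace HomogPart

/-! ### Dual partitions with respect to a kernel -/

/-- The dual of a partition of `X` with respect to a kernel `e : X → Y → ℂ`. -/
def kernelDual {X Y : Type*} (e : X → Y → ℂ) (P : Setoid X) : Setoid Y where
  r y y' := ∀ B ∈ P.classes, ∑ᶠ x ∈ B, e x y = ∑ᶠ x ∈ B, e x y'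
  iseqv :=
    { refl := fun _ _ _ => rfl
      symm := fun h B hB => (h B hB).symm
      trans := fun h h' B hB => (h B hB).trans (h' B hB) }

open scoped Classical in
theorem kernelDual_iff_sum {X Y : Type*} [Fintype X] (e : X → Y → ℂ) (P : Setoid X) (y y' : Y) :
    kernelDual e P y y' ↔
      ∀ a, (∑ x, if P x a then e x y else 0) = ∑ x, if P x a then e x y' else 0 := by
  have key : ∀ (a : X) (z : Y), ∑ᶠ x ∈ {x | P x a}, e x z = ∑ x, if P x a then e x z else 0 := by
    intro a z
    rw [finsum_mem_def, finsum_eq_sum_of_fintype]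
    refine Finset.sum_congr rfl fun x _ => ?_
    simp [Set.indicator_apply]
  constructor
  · intro h a
    rw [← key, ← key]
    exact h _ ⟨a, rfl⟩
  · rintro h B ⟨a, rfl⟩
    rw [key, key]
    exact h a

/-- The block indicators span the functions constant on blocks, so testing on all such functions is
equivalent and avoids handling blocks. -/
theorem kernelDual_iff {X Y : Type*} [Fintype X] (e : X → Y → ℂ) (P : Setoid X) (y y' : Y) :
    kernelDual e P y y' ↔ ∀ φ : X → ℂ, (∀ a b, P a b → φ a = φ b) →
      ∑ x, φ x * e x y = ∑ x, φ x * e x y' := by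
  classical
  rw [kernelDual_iff_sum]
  constructor
  · intro h φ hφ
    have key : ∀ z, ∑ x, φ x * e x z =
        ∑ c : Quotient P, φ c.out * ∑ x, if P x c.out then e x z else 0 := by
      intro z
      rw [← Finset.sum_fiberwise Finset.univ (fun x => (Quotient.mk P x))]
      refine Finset.sum_congr rfl fun c _ => ?_
      rw [← Finset.sum_filter, Finset.mul_sum]
      have hc : ∀ x, Quotient.mk P x = c ↔ P x c.out := by
        intro x
        conv_lhs => rw [← Quotient.out_eq c]
        exact Quotient.eq
      refine Finset.sum_congr (by ext x; simp [hc]) fun x hx => ?_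
      rw [hφ x c.out ((Finset.mem_filter.1 hx).2)]
    rw [key, key]
    exact Finset.sum_congr rfl fun c _ => by rw [h]
  · intro h a
    have := h (fun x => if P x a then 1 else 0) (by
      intro b c hbc
      have : P b a ↔ P c a := ⟨fun h' => P.trans (P.symm hbc) h', fun h' => P.trans hbc h'⟩
      simp [this])
    simpa using this

theorem kernelDual_mono {X Y : Type*} [Finite X] (e : X → Y → ℂ) {P Q : Setoid X} (h : P ≤ Q) :
    kernelDual e P ≤ kernelDual e Q := by
  have := Fintype.ofFinite X
  intro y y' hy
  have hy' := (kernelDual_iff e P y y').1 hy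
  exact (kernelDual_iff e Q y y').2 fun φ hφ => hy' φ fun a b hab => hφ a b (h hab)

/-- For an orthogonal kernel the bidual partition refines the given one. -/
theorem kernelDual_kernelDual_le {X Y : Type*} [Finite X] [Fintype Y] (e : X → Y → ℂ) {N : ℂ}
    (hN : N ≠ 0) (horth : ∀ x, ∑ y, starRingEnd ℂ (e x y) * e x y = N)
    (horth' : ∀ x x', x ≠ x' → ∑ y, starRingEnd ℂ (e x y) * e x' y = 0) (P : Setoid X) :
    kernelDual (fun y x => e x y) (kernelDual e P) ≤ P := by
  classical
  have := Fintype.ofFinite X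
  intro a b hab
  have hab' := (kernelDual_iff _ _ a b).1 hab
  set φ : X → ℂ := fun x => if P x a then 1 else 0 with hφ
  have hφP : ∀ x x', P x x' → φ x = φ x' := by
    intro b c hbc
    have : P b a ↔ P c a := ⟨fun h' => P.trans (P.symm hbc) h', fun h' => P.trans hbc h'⟩
    simp [hφ, this]
  -- Fourier inversion: orthogonality recovers the indicator `φ` of the block of `a` from its
  -- transform, which is constant on the dual blocks and hence a legal test function for `hab'`.
  have inv : ∀ z, ∑ y, starRingEnd ℂ (∑ x, φ x * e x y) * e z y =
      starRingEnd ℂ (φ z) * N := by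
    intro z
    simp only [map_sum, map_mul, Finset.sum_mul]
    rw [Finset.sum_comm, Finset.sum_eq_single z]
    · simp only [mul_assoc, ← Finset.mul_sum, horth]
    · intro x _ hx
      simp only [mul_assoc, ← Finset.mul_sum, horth' x z hx, mul_zero]
    · simp
  have h1 := hab' (fun y => starRingEnd ℂ (∑ x, φ x * e x y)) (by
    intro y y' hy
    rw [(kernelDual_iff e P y y').1 hy φ hφP])
  rw [inv, inv] at h1
  have h2 : φ a = φ b := by
    have := mul_right_cancel₀ hN h1
    exact (starRingEnd ℂ).injective this
  by_contra hcon
  have h4 : ¬ P b a := fun h => hcon (P.symm h)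
  simp [hφ, h4] at h2

/-! ### Pairings of finite abelian groups -/

/-- `e` is a nondegenerate bicharacter. -/
structure IsDualPairing {G H : Type*} [AddCommGroup G] [AddCommGroup H] (e : G → H → ℂ) :
    Prop where
  zero_left : ∀ h, e 0 h = 1
  zero_right : ∀ g, e g 0 = 1
  add_left : ∀ g g' h, e (g + g') h = e g h * e g' h
  add_right : ∀ g h h', e g (h + h') = e g h * e g h'
  nondeg_left : ∀ g, (∀ h, e g h = 1) → g = 0
  nondeg_right : ∀ h, (∀ g, e g h = 1) → h = 0

namespace IsDualPairing

variable {G H : Type*} [AddCommGroup G] [AddCommGroup H] {e : G → H → ℂ}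

theorem flip (he : IsDualPairing e) : IsDualPairing (fun h g => e g h) :=
  ⟨he.zero_right, he.zero_left, fun h h' g => he.add_right g h h',
    fun h g g' => he.add_left g g' h, he.nondeg_right, he.nondeg_left⟩

/-- The character `e g ·`. -/
def char (he : IsDualPairing e) (g : G) : AddChar H ℂ where
  toFun := e g
  map_zero_eq_one' := he.zero_right g
  map_add_eq_mul' := he.add_right g

theorem neg_left [Finite G] (he : IsDualPairing e) (g : G) (h : H) :
    e (-g) h = starRingEnd ℂ (e g h) :=
  (he.flip.char h).map_neg_eq_conj g

open scoped Classical in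
theorem sum_subgroup [Fintype H] (he : IsDualPairing e) (B : AddSubgroup H) (g : G) :
    (∑ h, if h ∈ B then e g h else 0) = if ∀ h ∈ B, e g h = 1 then (Nat.card B : ℂ) else 0 := by
  rw [← Finset.sum_filter, Finset.sum_subtype (p := fun h => h ∈ B) _ (by simp)]
  have h := AddChar.sum_eq_ite ((he.char g).compAddMonoidHom B.subtype)
  have h0 : (he.char g).compAddMonoidHom B.subtype = 0 ↔ ∀ h ∈ B, e g h = 1 := by
    rw [AddChar.ext_iff]
    constructor
    · intro h' x hx
      exact h' ⟨x, hx⟩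
    · intro h' x
      exact h' x x.2
  rw [Nat.card_eq_fintype_card]
  simp only [h0] at h
  exact h

open scoped Classical in
theorem sum_eq [Fintype H] (he : IsDualPairing e) (g : G) :
    ∑ h, e g h = if g = 0 then (Nat.card H : ℂ) else 0 := by
  have h := he.sum_subgroup ⊤ g
  simp only [AddSubgroup.mem_top, if_true, forall_const] at h
  have h0 : (∀ h, e g h = 1) ↔ g = 0 := ⟨he.nondeg_left g, fun h0 h => h0 ▸ he.zero_left h⟩
  rw [h]
  simp [h0]

theorem kernelDual_kernelDual_le [Finite G] [Finite H] (he : IsDualPairing e) (P : Setoid G) :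
    kernelDual (fun y x => e x y) (kernelDual e P) ≤ P := by
  classical
  have := Fintype.ofFinite H
  have key : ∀ x x', ∑ y, starRingEnd ℂ (e x y) * e x' y = ∑ y, e (-x + x') y := by
    intro x x'
    exact Finset.sum_congr rfl fun y _ => by rw [he.add_left, he.neg_left]
  refine HomogPart.kernelDual_kernelDual_le e (N := (Nat.card H : ℂ))
    (by exact_mod_cast Nat.card_pos.ne') ?_ ?_ P
  · intro x
    rw [key, he.sum_eq, if_pos (by simp)]
  · intro x x' h
    rw [key, he.sum_eq, if_neg]
    intro h'
    exact h (neg_add_eq_zero.1 h')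

/-- Two partitions whose block sums are constant on the blocks of the other are dual to each
other. -/
theorem kernelDual_eq [Finite G] [Finite H] (he : IsDualPairing e) {P : Setoid G} {Q : Setoid H}
    (hQ : Q ≤ kernelDual e P) (hP : P ≤ kernelDual (fun y x => e x y) Q) :
    kernelDual e P = Q ∧ kernelDual (fun y x => e x y) Q = P := by
  have h1 : kernelDual e P ≤ Q :=
    -- Dualizing P ≤ Q^ gives P^ ≤ Q^^, and Q^^ ≤ Q.
    (kernelDual_mono e hP).trans (he.flip.kernelDual_kernelDual_le Q)
  have h2 : kernelDual (fun y x => e x y) Q ≤ P :=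
    (kernelDual_mono _ hQ).trans (he.kernelDual_kernelDual_le P)
  exact ⟨le_antisymm h1 hQ, le_antisymm h2 hP⟩

/-- Subgroups that annihilate each other and have complementary orders are each other's
annihilators. -/
theorem mem_iff_of_card [Finite G] [Finite H] (he : IsDualPairing e) {A : AddSubgroup G}
    {B : AddSubgroup H} (hAB : ∀ a ∈ A, ∀ b ∈ B, e a b = 1)
    (hG : Nat.card A * Nat.card B = Nat.card G) (g : G) :
    (∀ b ∈ B, e g b = 1) ↔ g ∈ A := by
  classical
  have := Fintype.ofFinite H
  have := Fintype.ofFinite G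
  refine ⟨fun hg => ?_, fun hg => hAB g hg⟩
  -- Double counting of the sum of `e` over G × B: it is |B^⊥|·|B| when summed over B first, and |G|
  -- when summed over G first. So B^⊥ has the order of its subgroup A.
  have hswap : ∑ x, (∑ h, if h ∈ B then e x h else 0) =
      ∑ h, if h ∈ B then ∑ x, e x h else 0 := by
    rw [Finset.sum_comm]
    refine Finset.sum_congr rfl fun h _ => ?_
    split_ifs <;> simp
  have hl : ∑ x, (∑ h, if h ∈ B then e x h else 0) =
      (Finset.card {x | ∀ b ∈ B, e x b = 1} : ℂ) * Nat.card B := by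
    simp only [he.sum_subgroup, ← Finset.sum_filter, Finset.sum_const, nsmul_eq_mul]
  have hr : (∑ h, if h ∈ B then ∑ x, e x h else 0) = (Nat.card G : ℂ) := by
    rw [Finset.sum_eq_single 0]
    · rw [if_pos B.zero_mem, he.flip.sum_eq, if_pos rfl]
    · intro h _ h0
      rw [he.flip.sum_eq, if_neg h0, ite_self]
    · simp
  have hc : Finset.card {x | ∀ b ∈ B, e x b = 1} * Nat.card B = Nat.card A * Nat.card B := by
    rw [hG]
    exact_mod_cast (hl.symm.trans hswap).trans hr
  have hc' := Nat.eq_of_mul_eq_mul_right Nat.card_pos hc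
  have hA : Nat.card A = Finset.card {x | x ∈ A} := by
    rw [Nat.card_eq_fintype_card, Fintype.card_subtype]
  have hsub : (Finset.univ.filter fun x => x ∈ A) ⊆
      Finset.univ.filter fun x => ∀ b ∈ B, e x b = 1 := by
    intro x hx
    simp only [Finset.mem_filter, Finset.mem_univ, true_and] at hx ⊢
    exact hAB x hx
  have heq := Finset.eq_of_subset_of_card_le hsub (by rw [hc', hA])
  have : g ∈ Finset.univ.filter fun x => x ∈ A := by
    rw [heq]
    simpa using hg
  simpa using this

theorem eq_zero_of_pi {ι : Type*} [Fintype ι] {G H : ι → Type*} [∀ i, AddCommGroup (G i)]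
    [∀ i, AddCommGroup (H i)] {e : ∀ i, G i → H i → ℂ} (he : ∀ i, IsDualPairing (e i))
    (g : ∀ i, G i) (hg : ∀ h : ∀ i, H i, ∏ i, e i (g i) (h i) = 1) : g = 0 := by
  classical
  funext i
  refine (he i).nondeg_left _ fun h => ?_
  have := hg (Pi.single i h)
  rw [Finset.prod_eq_single i] at this
  · simpa using this
  · intro j _ hj
    rw [Pi.single_eq_of_ne hj, (he j).zero_right]
  · simp

/-- The product of nondegenerate pairings. -/
theorem pi {ι : Type*} [Fintype ι] {G H : ι → Type*} [∀ i, AddCommGroup (G i)]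
    [∀ i, AddCommGroup (H i)] {e : ∀ i, G i → H i → ℂ} (he : ∀ i, IsDualPairing (e i)) :
    IsDualPairing (fun (g : ∀ i, G i) (h : ∀ i, H i) => ∏ i, e i (g i) (h i)) :=
  ⟨fun h => Finset.prod_eq_one fun i _ => (he i).zero_left _,
    fun g => Finset.prod_eq_one fun i _ => (he i).zero_right _,
    fun g g' h => by simp [(he _).add_left, Finset.prod_mul_distrib],
    fun g h h' => by simp [(he _).add_right, Finset.prod_mul_distrib],
    eq_zero_of_pi he, eq_zero_of_pi fun i => (he i).flip⟩

end IsDualPairing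

/-! ### Sums over sets of vectors of given Hamming weight -/

/-- Marking each coordinate that satisfies `p` by X turns the sum into the coefficient of X^m in ∏
c_j (1 + β_j X), with β_j either β or β'. Apart from ∏ c_j, it depends on `s` only through the
number of j with `s j`. The constants `c j` may vanish. -/
theorem sum_prod_card_eq {κ : Type*} [Fintype κ] [DecidableEq κ] {X : κ → Type*} [∀ j, Fintype (X j)]
    (p : ∀ j, X j → Prop) [∀ j, DecidablePred (p j)] (f : ∀ j, X j → ℂ) (c : κ → ℂ) (β β' : ℂ)
    (s : κ → Prop) [DecidablePred s]
    (h0 : ∀ j, (∑ x, if p j x then 0 else f j x) = c j)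
    (h1 : ∀ j, (∑ x, if p j x then f j x else 0) = c j * if s j then β else β') (m : ℕ) :
    (∑ x : ∀ j, X j, if Finset.card {j | p j (x j)} = m then ∏ j, f j (x j) else 0) =
      (∏ j, c j) * ((1 + Polynomial.C β * Polynomial.X) ^ Finset.card {j | s j} *
        (1 + Polynomial.C β' * Polynomial.X) ^
          (Fintype.card κ - Finset.card {j | s j})).coeff m := by
  have hs : Fintype.card κ - Finset.card {j | s j} = Finset.card {j | ¬ s j} := by
    rw [← Finset.card_univ, ← Finset.card_filter_add_card_filter_not (s := Finset.univ) s]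
    simp
  rw [hs]
  have hl : ∏ j, ∑ x, Polynomial.C (f j x) * (if p j x then Polynomial.X else 1) =
      ∏ j, Polynomial.C (c j) * (1 + Polynomial.C (if s j then β else β') * Polynomial.X) := by
    refine Finset.prod_congr rfl fun j _ => ?_
    have : ∀ x, Polynomial.C (f j x) * (if p j x then Polynomial.X else 1) =
        Polynomial.C (if p j x then 0 else f j x) +
          Polynomial.C (if p j x then f j x else 0) * Polynomial.X := by
      intro x
      split_ifs <;> simp
    simp only [this, Finset.sum_add_distrib, ← Finset.sum_mul, ← map_sum, h0, h1]
    rw [map_mul]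
    ring
  have hr : ∏ j, Polynomial.C (c j) * (1 + Polynomial.C (if s j then β else β') * Polynomial.X) =
      Polynomial.C (∏ j, c j) * ((1 + Polynomial.C β * Polynomial.X) ^ Finset.card {j | s j} *
        (1 + Polynomial.C β' * Polynomial.X) ^ Finset.card {j | ¬ s j}) := by
    rw [Finset.prod_mul_distrib, map_prod]
    congr 1
    rw [← Finset.prod_const, ← Finset.prod_const, ← Finset.prod_ite]
    refine Finset.prod_congr rfl fun j _ => ?_
    split_ifs <;> rfl
  rw [hr, Fintype.prod_sum] at hl
  have := congrArg (fun P => Polynomial.coeff P m) hl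
  simp only [Polynomial.coeff_C_mul, Polynomial.finsetSum_coeff] at this
  rw [← this]
  refine Finset.sum_congr rfl fun x _ => ?_
  rw [Finset.prod_mul_distrib, ← map_prod, Polynomial.coeff_C_mul, Finset.prod_ite,
    Finset.prod_const_one, mul_one, Finset.prod_const, Polynomial.coeff_X_pow]
  simp [eq_comm]

theorem sum_prod_prod_card_eq {ι : Type*} [Fintype ι] [DecidableEq ι] {κ : ι → Type*} [∀ i, Fintype (κ i)]
    [∀ i, DecidableEq (κ i)]
    {X : ∀ i, κ i → Type*} [∀ i j, Fintype (X i j)]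
    (p : ∀ i j, X i j → Prop) [∀ i j, DecidablePred (p i j)] (f : ∀ i j, X i j → ℂ) (c : ∀ i, κ i → ℂ) (β β' : ι → ℂ)
    (s : ∀ i, κ i → Prop) [∀ i, DecidablePred (s i)]
    (h0 : ∀ i j, (∑ x, if p i j x then 0 else f i j x) = c i j)
    (h1 : ∀ i j, (∑ x, if p i j x then f i j x else 0) = c i j * if s i j then β i else β' i)
    (m : ι → ℕ) :
    (∑ x : ∀ i j, X i j, if ∀ i, Finset.card {j | p i j (x i j)} = m i
        then ∏ i, ∏ j, f i j (x i j) else 0) =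
      (∏ i, ∏ j, c i j) *
        ∏ i, ((1 + Polynomial.C (β i) * Polynomial.X) ^ Finset.card {j | s i j} *
          (1 + Polynomial.C (β' i) * Polynomial.X) ^
            (Fintype.card (κ i) - Finset.card {j | s i j})).coeff (m i) := by
  rw [← Finset.prod_mul_distrib, ← Finset.prod_congr rfl fun i _ =>
    sum_prod_card_eq (p i) (f i) (c i) (β i) (β' i) (s i) (h0 i) (h1 i) (m i), Fintype.prod_sum]
  refine Finset.sum_congr rfl fun x _ => ?_
  rw [Finset.prod_ite_zero]
  simp

theorem wt_eq_card {n : ℕ} {A : Fin n → Type*} [∀ j, Zero (A j)] (x : ∀ j, A j)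
    [DecidablePred fun j => x j ≠ 0] : wt x = Finset.card {j | x j ≠ 0} := by
  unfold wt hammingNorm
  congr

/-- For subgroups `A i j`, the Hamming product partition on `∏ A i j`, extended by the block of
all remaining elements. -/
noncomputable def extendedHamming {t : ℕ} {n : Fin t → ℕ} {G : ∀ i, Fin (n i) → Type*}
    [∀ i j, AddCommGroup (G i j)] (A : ∀ i j, AddSubgroup (G i j)) : Setoid (∀ i j, G i j) :=
  extendPartition {x | ∀ i j, x i j ∈ A i j}
    (Setoid.comap Subtype.val (prodPartition fun i => hammingPartition (G i)))

open scoped Classical in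
/-- For subgroups `B i j`, the pullback of the Hamming product partition on `∏ H i j / B i j`,
with `0` split off. -/
noncomputable def quotientHamming {t : ℕ} {n : Fin t → ℕ} {H : ∀ i, Fin (n i) → Type*}
    [∀ i j, AddCommGroup (H i j)] (B : ∀ i j, AddSubgroup (H i j)) : Setoid (∀ i j, H i j) :=
  Setoid.ker fun v => ((v = 0 : Prop), fun i => Finset.card {j | v i j ∉ B i j})

/-! ### Character sums in a single coordinate -/

section
variable {G H : Type*} [AddCommGroup G] [AddCommGroup H] {e : G → H → ℂ}

open scoped Classical in
-- The full sum over A is |A| or 0 according as v lies in A^⊥ = B, and the term at 0 is 1. The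
-- factor `1` plays the role of `c j` in `sum_prod_card_eq`.
theorem IsDualPairing.sum_nonzero_subgroup [Fintype G] [Finite H] (he : IsDualPairing e)
    {A : AddSubgroup G} {B : AddSubgroup H} (hAB : ∀ a ∈ A, ∀ b ∈ B, e a b = 1)
    (hH : Nat.card A * Nat.card B = Nat.card H) (v : H) :
    (∑ w, if w ≠ 0 then (if w ∈ A then e w v else 0) else 0) =
      1 * if v ∉ B then (-1 : ℂ) else (Nat.card A : ℂ) - 1 := by
  have h1 : ∀ w, (if w ≠ 0 then (if w ∈ A then e w v else 0) else 0) =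
      (if w ∈ A then e w v else 0) - if w = 0 then 1 else 0 := by
    intro w
    by_cases hw : w = 0
    · simp [hw, A.zero_mem, he.zero_left]
    · simp [hw]
  rw [Finset.sum_congr rfl fun w _ => h1 w, Finset.sum_sub_distrib, he.flip.sum_subgroup A v]
  have h2 := he.flip.mem_iff_of_card (A := B) (B := A) (fun b hb a ha => hAB a ha b hb)
    (by rw [mul_comm, hH]) v
  simp only [h2]
  by_cases hv : v ∈ B <;> simp [hv]

open scoped Classical in
-- The sum over H, which is |A||B| or 0, minus the sum over B, which is |B| or 0. Pulling out
-- |B|·1_A(g) leaves the same values -1 and |A| - 1 as in the sum over A \ {0}.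
theorem IsDualPairing.sum_compl_subgroup [Finite G] [Fintype H] (he : IsDualPairing e)
    {A : AddSubgroup G} {B : AddSubgroup H} (hAB : ∀ a ∈ A, ∀ b ∈ B, e a b = 1)
    (hG : Nat.card A * Nat.card B = Nat.card G) (hH : Nat.card A * Nat.card B = Nat.card H)
    (g : G) :
    (∑ v, if v ∉ B then e g v else 0) =
      (if g ∈ A then (Nat.card B : ℂ) else 0) *
        if g ≠ 0 then (-1 : ℂ) else (Nat.card A : ℂ) - 1 := by
  have h1 : ∀ v, (if v ∉ B then e g v else 0) = e g v - if v ∈ B then e g v else 0 := by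
    intro v
    by_cases hv : v ∈ B <;> simp [hv]
  rw [Finset.sum_congr rfl fun w _ => h1 w, Finset.sum_sub_distrib, he.sum_subgroup, he.sum_eq]
  simp only [he.mem_iff_of_card hAB hG]
  by_cases hg : g = 0
  · simp only [hg, A.zero_mem, if_true, ne_eq, not_true_eq_false, if_false, ← hH]
    push_cast
    ring
  · simp [hg]

end

/-! ### Mutual duality of the two partitions on the product -/

section
variable {t : ℕ} {n : Fin t → ℕ} {G H : ∀ i, Fin (n i) → Type*} [∀ i j, AddCommGroup (G i j)]
  [∀ i j, AddCommGroup (H i j)]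
  {A : ∀ i j, AddSubgroup (G i j)} {B : ∀ i j, AddSubgroup (H i j)} {q : Fin t → ℕ}
  {e : ∀ i j, G i j → H i j → ℂ}

theorem extendedHamming_iff {w w' : ∀ i j, G i j} : extendedHamming A w w' ↔
    ((¬ ∀ i j, w i j ∈ A i j) ∧ ¬ ∀ i j, w' i j ∈ A i j) ∨
      ((∀ i j, w i j ∈ A i j) ∧ (∀ i j, w' i j ∈ A i j) ∧ ∀ i, wt (w i) = wt (w' i)) := by
  constructor
  · rintro (h | ⟨h, h', h''⟩)
    · exact Or.inl h
    · exact Or.inr ⟨h, h', h''⟩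
  · rintro (h | ⟨h, h', h''⟩)
    · exact Or.inl h
    · exact Or.inr ⟨h, h', h''⟩

open scoped Classical in
theorem quotientHamming_iff {v v' : ∀ i j, H i j} : quotientHamming B v v' ↔
    (v = 0 ↔ v' = 0) ∧
      ∀ i, Finset.card {j | v i j ∉ B i j} = Finset.card {j | v' i j ∉ B i j} := by
  rw [quotientHamming, Setoid.ker_def, Prod.mk.injEq, eq_iff_iff]
  exact and_congr Iff.rfl funext_iff

open scoped Classical in
theorem sum_wt_eq [∀ i j, Fintype (G i j)] [∀ i j, Finite (H i j)]
    (he : ∀ i j, IsDualPairing (e i j)) (hAB : ∀ i j, ∀ a ∈ A i j, ∀ b ∈ B i j, e i j a b = 1)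
    (hH : ∀ i j, Nat.card (A i j) * Nat.card (B i j) = Nat.card (H i j))
    (hA : ∀ i j, Nat.card (A i j) = q i) {v v' : ∀ i j, H i j}
    (hv : ∀ i, Finset.card {j | v i j ∉ B i j} = Finset.card {j | v' i j ∉ B i j})
    (m : Fin t → ℕ) :
    (∑ w : ∀ i j, G i j, if (∀ i j, w i j ∈ A i j) ∧ ∀ i, wt (w i) = m i then
      ∏ i, ∏ j, e i j (w i j) (v i j) else 0) =
    ∑ w : ∀ i j, G i j, if (∀ i j, w i j ∈ A i j) ∧ ∀ i, wt (w i) = m i then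
      ∏ i, ∏ j, e i j (w i j) (v' i j) else 0 := by
  have key := fun u : ∀ i j, H i j => sum_prod_prod_card_eq (fun i j (w : G i j) => w ≠ 0)
    (fun i j w => if w ∈ A i j then e i j w (u i j) else 0) (fun _ _ => 1) (fun _ => -1)
    (fun i => (q i : ℂ) - 1) (fun i j => u i j ∉ B i j)
    (fun i j => by
      rw [Finset.sum_eq_single 0]
      · simp [(A i j).zero_mem, (he i j).zero_left]
      · intro w _ hw
        simp [hw]
      · simp)
    (fun i j => by rw [(he i j).sum_nonzero_subgroup (hAB i j) (hH i j), hA]) m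
  have hl : ∀ (u : ∀ i j, H i j) (w : ∀ i j, G i j),
      (if (∀ i j, w i j ∈ A i j) ∧ ∀ i, wt (w i) = m i then
        ∏ i, ∏ j, e i j (w i j) (u i j) else 0) =
      if ∀ i, Finset.card {j | w i j ≠ 0} = m i then
        ∏ i, ∏ j, (if w i j ∈ A i j then e i j (w i j) (u i j) else 0) else 0 := by
    intro u w
    simp only [Finset.prod_ite_zero, Finset.mem_univ, true_imp_iff, wt_eq_card]
    rw [← ite_and]
    simp only [and_comm]
  simp only [hl]
  have h := key v
  simp only [hv] at h
  convert h.trans (key v').symm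

open scoped Classical in
theorem sum_quotient_eq [∀ i j, Finite (G i j)] [∀ i j, Fintype (H i j)]
    (he : ∀ i j, IsDualPairing (e i j)) (hAB : ∀ i j, ∀ a ∈ A i j, ∀ b ∈ B i j, e i j a b = 1)
    (hG : ∀ i j, Nat.card (A i j) * Nat.card (B i j) = Nat.card (G i j))
    (hH : ∀ i j, Nat.card (A i j) * Nat.card (B i j) = Nat.card (H i j))
    (hA : ∀ i j, Nat.card (A i j) = q i) {w w' : ∀ i j, G i j} (hw : extendedHamming A w w')
    (m : Fin t → ℕ) :
    (∑ v : ∀ i j, H i j, if ∀ i, Finset.card {j | v i j ∉ B i j} = m i then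
      ∏ i, ∏ j, e i j (w i j) (v i j) else 0) =
    ∑ v : ∀ i j, H i j, if ∀ i, Finset.card {j | v i j ∉ B i j} = m i then
      ∏ i, ∏ j, e i j (w' i j) (v i j) else 0 := by
  have key := fun u : ∀ i j, G i j => sum_prod_prod_card_eq (fun i j (v : H i j) => v ∉ B i j)
    (fun i j v => e i j (u i j) v) (fun i j => if u i j ∈ A i j then (Nat.card (B i j) : ℂ) else 0)
    (fun _ => -1) (fun i => (q i : ℂ) - 1) (fun i j => u i j ≠ 0)
    (fun i j => by
      simp only [ite_not]
      rw [(he i j).sum_subgroup]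
      simp only [(he i j).mem_iff_of_card (hAB i j) (hG i j)])
    (fun i j => by rw [(he i j).sum_compl_subgroup (hAB i j) (hG i j) (hH i j), hA]) m
  -- A single coordinate outside A annihilates every such sum, which is why all vectors outside ∏ A
  -- can form one block.
  have hz : ∀ u : ∀ i j, G i j, (¬ ∀ i j, u i j ∈ A i j) →
      ∏ i, ∏ j, (if u i j ∈ A i j then (Nat.card (B i j) : ℂ) else 0) = 0 := by
    intro u hu
    push Not at hu
    obtain ⟨i, j, hij⟩ := hu
    exact Finset.prod_eq_zero (Finset.mem_univ i)
      (Finset.prod_eq_zero (Finset.mem_univ j) (if_neg hij))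
  refine Eq.trans (by convert key w) (Eq.trans ?_ (Eq.symm (by convert key w')))
  rcases extendedHamming_iff.1 hw with ⟨h, h'⟩ | ⟨h, h', hwt⟩
  · rw [hz w h, hz w' h', zero_mul, zero_mul]
  · simp only [h, h', if_true]
    simp only [wt_eq_card] at hwt
    simp only [hwt]

theorem quotientHamming_le [∀ i j, Finite (G i j)] [∀ i j, Finite (H i j)]
    (he : ∀ i j, IsDualPairing (e i j)) (hAB : ∀ i j, ∀ a ∈ A i j, ∀ b ∈ B i j, e i j a b = 1)
    (hH : ∀ i j, Nat.card (A i j) * Nat.card (B i j) = Nat.card (H i j))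
    (hA : ∀ i j, Nat.card (A i j) = q i) :
    quotientHamming B ≤
      kernelDual (fun w v => ∏ i, ∏ j, e i j (w i j) (v i j)) (extendedHamming A) := by
  classical
  have := fun i j => Fintype.ofFinite (G i j)
  intro v v' hv
  rw [quotientHamming_iff] at hv
  obtain ⟨hv0, hv⟩ := hv
  have hE := IsDualPairing.pi fun i => IsDualPairing.pi fun j => he i j
  have hm := sum_wt_eq he hAB hH hA hv
  rw [kernelDual_iff_sum]
  have hin : ∀ a : ∀ i j, G i j, (∀ i j, a i j ∈ A i j) → ∀ w, extendedHamming A w a ↔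
      (∀ i j, w i j ∈ A i j) ∧ ∀ i, wt (w i) = wt (a i) := by
    intro a ha w
    rw [extendedHamming_iff]
    tauto
  -- Obtained by adding the sums of `hm` over all weight profiles.
  have hsoc : (∑ w : ∀ i j, G i j, if ∀ i j, w i j ∈ A i j then
      ∏ i, ∏ j, e i j (w i j) (v i j) else 0) =
      ∑ w : ∀ i j, G i j, if ∀ i j, w i j ∈ A i j then
        ∏ i, ∏ j, e i j (w i j) (v' i j) else 0 := by
    rw [← Finset.sum_filter, ← Finset.sum_filter]
    have hmaps : ∀ w ∈ Finset.univ.filter (fun w : ∀ i j, G i j => ∀ i j, w i j ∈ A i j),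
        (fun i => wt (w i)) ∈ Finset.univ.image fun w : ∀ i j, G i j => fun i => wt (w i) :=
      fun w _ => Finset.mem_image_of_mem _ (Finset.mem_univ w)
    rw [← Finset.sum_fiberwise_of_maps_to hmaps, ← Finset.sum_fiberwise_of_maps_to hmaps]
    refine Finset.sum_congr rfl fun m _ => ?_
    rw [Finset.filter_filter, Finset.sum_filter, Finset.sum_filter]
    simp only [funext_iff]
    exact hm m
  intro a
  by_cases ha : ∀ i j, a i j ∈ A i j
  · simp only [hin a ha]
    exact hm _
  -- The outer block is the whole group minus ∏ A. The sum over the whole group is nonzero only at v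
  -- = 0, so this block is what forces 0 to be isolated in the dual.
  · have hout : ∀ (u : ∀ i j, H i j) (w : ∀ i j, G i j),
        (if extendedHamming A w a then ∏ i, ∏ j, e i j (w i j) (u i j) else 0) =
        (∏ i, ∏ j, e i j (w i j) (u i j)) -
          if ∀ i j, w i j ∈ A i j then ∏ i, ∏ j, e i j (w i j) (u i j) else 0 := by
      intro u w
      have : extendedHamming A w a ↔ ¬ ∀ i j, w i j ∈ A i j := by
        rw [extendedHamming_iff]
        tauto
      by_cases hw : ∀ i j, w i j ∈ A i j
      · simp [this.not.2 (not_not.2 hw), hw]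
      · simp only [this.2 hw, hw, if_true, if_false, sub_zero]
    simp only [hout, Finset.sum_sub_distrib, hsoc]
    rw [hE.flip.sum_eq v, hE.flip.sum_eq v']
    by_cases h : v = 0
    · rw [if_pos h, if_pos (hv0.1 h)]
    · rw [if_neg h, if_neg (mt hv0.2 h)]

theorem extendedHamming_le [∀ i j, Finite (G i j)] [∀ i j, Finite (H i j)]
    (he : ∀ i j, IsDualPairing (e i j)) (hAB : ∀ i j, ∀ a ∈ A i j, ∀ b ∈ B i j, e i j a b = 1)
    (hG : ∀ i j, Nat.card (A i j) * Nat.card (B i j) = Nat.card (G i j))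
    (hH : ∀ i j, Nat.card (A i j) * Nat.card (B i j) = Nat.card (H i j))
    (hA : ∀ i j, Nat.card (A i j) = q i) :
    extendedHamming A ≤
      kernelDual (fun v w => ∏ i, ∏ j, e i j (w i j) (v i j)) (quotientHamming B) := by
  classical
  have := fun i j => Fintype.ofFinite (H i j)
  intro w w' hw
  have hE := IsDualPairing.pi fun i => IsDualPairing.pi fun j => he i j
  have hm := sum_quotient_eq he hAB hG hH hA hw
  rw [kernelDual_iff_sum]
  intro a
  by_cases ha : a = 0
  · have : ∀ v, quotientHamming B v a ↔ v = 0 := by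
      intro v
      rw [quotientHamming_iff]
      constructor
      · intro h
        exact h.1.2 ha
      · rintro rfl
        simp [ha]
    simp only [this, Finset.sum_ite_eq', Finset.mem_univ, if_true]
    exact (hE.zero_right w).trans (hE.zero_right w').symm
  -- The block of a nonzero `a` is its count class without 0. The vector 0 lies in that class only
  -- if all counts of `a` vanish, and its term 1 does not depend on `u`.
  · have hs : ∀ (u : ∀ i j, G i j) (v : ∀ i j, H i j),
        (if quotientHamming B v a then ∏ i, ∏ j, e i j (u i j) (v i j) else 0) =
        (if ∀ i, Finset.card {j | v i j ∉ B i j} = Finset.card {j | a i j ∉ B i j} then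
          ∏ i, ∏ j, e i j (u i j) (v i j) else 0) -
        if v = 0 then (if ∀ i, 0 = Finset.card {j | a i j ∉ B i j} then 1 else 0) else 0 := by
      intro u v
      rw [quotientHamming_iff]
      by_cases hv : v = 0
      · subst hv
        have := hE.zero_right u
        simp only [Pi.zero_apply] at this
        simp [ha, (B _ _).zero_mem, this]
      · simp [ha, hv]
    simp only [hs, Finset.sum_sub_distrib, hm]

/-- The partitions `extendedHamming A` and `quotientHamming B` are dual to each other. -/
theorem kernelDual_extendedHamming [∀ i j, Finite (G i j)] [∀ i j, Finite (H i j)]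
    (he : ∀ i j, IsDualPairing (e i j)) (hAB : ∀ i j, ∀ a ∈ A i j, ∀ b ∈ B i j, e i j a b = 1)
    (hG : ∀ i j, Nat.card (A i j) * Nat.card (B i j) = Nat.card (G i j))
    (hH : ∀ i j, Nat.card (A i j) * Nat.card (B i j) = Nat.card (H i j))
    (hA : ∀ i j, Nat.card (A i j) = q i) :
    kernelDual (fun w v => ∏ i, ∏ j, e i j (w i j) (v i j)) (extendedHamming A) =
        quotientHamming B ∧
      kernelDual (fun v w => ∏ i, ∏ j, e i j (w i j) (v i j)) (quotientHamming B) =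
        extendedHamming A :=
  (IsDualPairing.pi fun i => IsDualPairing.pi fun j => he i j).kernelDual_eq
    (quotientHamming_le he hAB hH hA) (extendedHamming_le he hAB hG hH hA)

end

/-! ### Simple left ideals and the socle -/

theorem isSimpleModule_span_iff {R : Type*} [Ring R] (x : R) :
    IsSimpleModule R (Ideal.span {x} : Ideal R) ↔
      x ≠ 0 ∧ ∀ s : R, s * x ≠ 0 → ∃ r, r * (s * x) = x := by
  rw [isSimpleModule_iff_isAtom]
  constructor
  · rintro ⟨h0, h⟩
    refine ⟨fun hx => h0 (by simp [hx]), fun s hs => ?_⟩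
    by_contra hcon
    have hlt : Ideal.span {s * x} < (Ideal.span {x} : Ideal R) := by
      refine lt_of_le_of_ne ?_ fun heq => hcon ?_
      · rw [Ideal.span_singleton_le_iff_mem]
        exact Ideal.mul_mem_left _ _ (Ideal.mem_span_singleton_self x)
      · exact Ideal.mem_span_singleton'.1 (heq ▸ Ideal.mem_span_singleton_self x)
    exact hs (Ideal.span_singleton_eq_bot.1 (h _ hlt))
  · rintro ⟨h0, h⟩
    refine ⟨fun hx => h0 (Ideal.span_singleton_eq_bot.1 hx), fun I hI => ?_⟩
    by_contra hne
    obtain ⟨y, hy, hy0⟩ := Submodule.exists_mem_ne_zero_of_ne_bot hne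
    obtain ⟨s, rfl⟩ := Ideal.mem_span_singleton'.1 (hI.le hy)
    obtain ⟨r, hr⟩ := h s hy0
    refine hI.not_ge ?_
    rw [Ideal.span_singleton_le_iff_mem, ← hr]
    exact I.smul_mem r hy

theorem eq_span_of_isSimpleModule {R : Type*} [Ring R] {I : Ideal R} (hI : IsSimpleModule R I)
    {x : R} (hx : x ∈ I) (h0 : x ≠ 0) : I = Ideal.span {x} := by
  rw [isSimpleModule_iff_isAtom] at hI
  have hle : Ideal.span {x} ≤ I := (Ideal.span_singleton_le_iff_mem I).2 hx
  rcases hI.le_iff.1 hle with h | h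
  · exact absurd (Ideal.span_singleton_eq_bot.1 h) h0
  · exact h.symm

theorem mem_socle_of_isSimpleModule {R : Type*} [Ring R] {x : R}
    (h : IsSimpleModule R (Ideal.span {x} : Ideal R)) : x ∈ socle R :=
  (le_sSup (a := Ideal.span {x}) (s := {I : Ideal R | IsSimpleModule R I}) h)
    (Ideal.mem_span_singleton_self x)

theorem socle_eq_top_iff (R : Type*) [Ring R] : socle R = ⊤ ↔ IsSemisimpleRing R :=
  sSup_simples_eq_top_iff_isSemisimpleModule

/-- The socle of a finite product of rings is the product of the socles. -/
theorem mem_socle_pi {ι : Type*} [Finite ι] {S : ι → Type*} [∀ i, Ring (S i)] (x : ∀ i, S i) :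
    x ∈ socle (∀ i, S i) ↔ ∀ i, x i ∈ socle (S i) := by
  classical
  have := Fintype.ofFinite ι
  constructor
  · intro hx i
    have hle : socle (∀ i, S i) ≤ (socle (S i)).comap (Pi.evalRingHom S i) := by
      refine sSup_le fun I hI y hy => ?_
      change y i ∈ socle (S i)
      by_cases h0 : y i = 0
      · rw [h0]
        exact zero_mem _
      refine mem_socle_of_isSimpleModule ((isSimpleModule_span_iff _).2 ⟨h0, fun s hs => ?_⟩)
      have hz : Pi.single i s * y = Pi.single i (s * y i) := by
        rw [← Pi.single_mul_left]
      have hz0 : Pi.single i s * y ≠ 0 := by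
        rw [hz]
        simpa using hs
      have hspan := eq_span_of_isSimpleModule hI (I.mul_mem_left (Pi.single i s) hy) hz0
      rw [hspan] at hy
      obtain ⟨r, hr⟩ := Ideal.mem_span_singleton'.1 hy
      refine ⟨r i, ?_⟩
      have := congrFun hr i
      rwa [hz, Pi.mul_apply, Pi.single_eq_same] at this
    exact hle hx
  · intro hx
    have hsum : x = ∑ i, Pi.single i (x i) := (Finset.univ_sum_single x).symm
    rw [hsum]
    refine Ideal.sum_mem _ fun i _ => ?_
    let T : Ideal (S i) :=
      { carrier := {y | (Pi.single i y : ∀ i, S i) ∈ socle (∀ i, S i)}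
        add_mem' := fun {a b} ha hb => by
          change (Pi.single i (a + b) : ∀ i, S i) ∈ socle (∀ i, S i)
          rw [Pi.single_add]
          exact add_mem ha hb
        zero_mem' := by
          change (Pi.single i 0 : ∀ i, S i) ∈ socle (∀ i, S i)
          rw [Pi.single_zero]
          exact zero_mem _
        smul_mem' := fun c a ha => by
          change (Pi.single i (c * a) : ∀ i, S i) ∈ socle (∀ i, S i)
          rw [Pi.single_mul]
          exact Ideal.mul_mem_left _ _ ha }
    have hle : socle (S i) ≤ T := by
      refine sSup_le fun I hI y hy => ?_
      change (Pi.single i y : ∀ i, S i) ∈ socle (∀ i, S i)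
      by_cases h0 : y = 0
      · rw [h0, Pi.single_zero]
        exact zero_mem _
      have hI' : IsSimpleModule (S i) I := hI
      rw [eq_span_of_isSimpleModule hI' hy h0, isSimpleModule_span_iff] at hI'
      refine mem_socle_of_isSimpleModule
        ((isSimpleModule_span_iff _).2 ⟨by simpa using h0, fun s hs => ?_⟩)
      have hz : s * Pi.single i y = Pi.single i (s i * y) := by
        rw [← Pi.single_mul_right]
      rw [hz] at hs ⊢
      obtain ⟨r, hr⟩ := hI'.2 (s i) (by simpa using hs)
      refine ⟨Pi.single i r, ?_⟩
      rw [← Pi.single_mul, hr]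
    exact hle (hx i)

/-! ### Finite local rings whose socle has the size of the residue ring -/

theorem mem_jacobson_iff_not_isUnit {S : Type*} [Ring S] [Finite S] [IsLocalRing S] (x : S) :
    x ∈ Ring.jacobson S ↔ ¬ IsUnit x := by
  have hmax : ∀ m : Ideal S, m.IsMaximal → ∀ y, ¬ IsUnit y → y ∈ m := by
    intro m hm y hy
    by_contra hym
    obtain ⟨z, hz, i, hi, h1⟩ : ∃ z ∈ Ideal.span {y}, ∃ i ∈ m, z + i = 1 := by
      have : Ideal.span {y} ⊔ m = ⊤ := by
        rw [sup_comm]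
        refine hm.1.2 _ (left_lt_sup.2 fun h => hym (h (Ideal.mem_span_singleton_self y)))
      exact Submodule.mem_sup.1 (this ▸ Submodule.mem_top)
    obtain ⟨s, rfl⟩ := Ideal.mem_span_singleton'.1 hz
    -- One summand of `s * y + i = 1` is a unit. If it is `s * y`, then `y` has a left inverse,
    -- which suffices in a finite ring; if it is `i`, then `m` is not proper.
    rcases IsLocalRing.isUnit_or_isUnit_of_add_one h1 with h | h
    · obtain ⟨u, hu⟩ := h
      refine hy (IsUnit.of_mul_eq_one_right (↑u⁻¹ * s) ?_)
      rw [mul_assoc, ← hu, Units.inv_mul]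
    · exact hm.ne_top (Ideal.eq_top_of_isUnit_mem _ hi h)
  rw [Ring.jacobson_eq_sInf_isMaximal, Submodule.mem_sInf]
  constructor
  · intro h hu
    obtain ⟨m, hm⟩ := Ideal.exists_maximal S
    exact hm.ne_top (Ideal.eq_top_of_isUnit_mem _ (h m hm) hu)
  · intro h m hm
    exact hmax m hm x h

theorem card_mul_card_jacobson (S : Type*) [Ring S] :
    Nat.card (S ⧸ Ring.jacobson S) * Nat.card (Ring.jacobson S) = Nat.card S := by
  rw [Submodule.card_eq_card_quotient_mul_card (Ring.jacobson S), mul_comm]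

section
variable {S : Type*} [Ring S] [Finite S] [IsLocalRing S]

theorem isUnit_one_sub {j : S} (hj : j ∈ Ring.jacobson S) : IsUnit (1 - j) := by
  rcases IsLocalRing.isUnit_or_isUnit_of_add_one (add_sub_cancel j 1) with h | h
  · exact absurd h ((mem_jacobson_iff_not_isUnit j).1 hj)
  · exact h

theorem one_lt_card_quotient_jacobson : 1 < Nat.card (S ⧸ Ring.jacobson S) := by
  have : Nontrivial (S ⧸ Ring.jacobson S) :=
    Submodule.Quotient.nontrivial_iff.2 (Ring.jacobson_lt_top S).ne
  have : Finite (S ⧸ Ring.jacobson S) := Finite.of_surjective _ (Submodule.mkQ_surjective _)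
  exact Finite.one_lt_card

/-- A nonzero principal left ideal annihilated by the radical has the size of the residue ring. -/
theorem card_span_of_jacobson_mul {x : S} (h0 : x ≠ 0)
    (hx : ∀ j ∈ Ring.jacobson S, j * x = 0) :
    Nat.card (Ideal.span {x} : Ideal S) = Nat.card (S ⧸ Ring.jacobson S) := by
  have hker : Ring.jacobson S = LinearMap.ker (LinearMap.toSpanSingleton S S x) := by
    ext s
    rw [LinearMap.mem_ker, LinearMap.toSpanSingleton_apply, smul_eq_mul]
    refine ⟨hx s, fun hs => (mem_jacobson_iff_not_isUnit s).2 fun hu => h0 ?_⟩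
    exact (hu.mul_right_eq_zero).1 hs
  have e := (LinearMap.toSpanSingleton S S x).quotKerEquivRange
  rw [LinearMap.range_toSpanSingleton, ← hker] at e
  exact (Nat.card_congr e.toEquiv).symm

theorem jacobson_mul_of_isSimpleModule {x : S} (hx : IsSimpleModule S (Ideal.span {x} : Ideal S)) :
    ∀ j ∈ Ring.jacobson S, j * x = 0 := by
  intro j hj
  by_contra h
  obtain ⟨r, hr⟩ := ((isSimpleModule_span_iff x).1 hx).2 j h
  have h1 : (1 - r * j) * x = 0 := by
    rw [sub_mul, one_mul, mul_assoc, hr, sub_self]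
  exact ((isSimpleModule_span_iff x).1 hx).1
    (((isUnit_one_sub (Ideal.mul_mem_left _ r hj)).mul_right_eq_zero).1 h1)

theorem isSimpleModule_span_of_jacobson_mul {x : S} (h0 : x ≠ 0)
    (hx : ∀ j ∈ Ring.jacobson S, j * x = 0) : IsSimpleModule S (Ideal.span {x} : Ideal S) := by
  refine (isSimpleModule_span_iff x).2 ⟨h0, fun s hs => ?_⟩
  have hu : IsUnit s := by
    by_contra hu
    exact hs (hx s ((mem_jacobson_iff_not_isUnit s).2 hu))
  obtain ⟨u, rfl⟩ := hu
  exact ⟨↑u⁻¹, by rw [← mul_assoc, Units.inv_mul, one_mul]⟩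

/-- If the radical kills x ≠ 0, any s with sx ≠ 0 is a unit, so Sx is simple. Conversely, if Sx is
simple and jx ≠ 0, then rjx = x for some r, against 1 - rj being a unit. -/
theorem mem_socle_iff_jacobson_mul (x : S) :
    x ∈ socle S ↔ ∀ j ∈ Ring.jacobson S, j * x = 0 := by
  constructor
  · intro hx j hj
    let T : Ideal S :=
      { carrier := {y | ∀ j ∈ Ring.jacobson S, j * y = 0}
        add_mem' := fun {a b} ha hb j hj => by rw [mul_add, ha j hj, hb j hj, add_zero]
        zero_mem' := fun j _ => mul_zero j
        smul_mem' := fun c a ha j hj => by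
          rw [smul_eq_mul, ← mul_assoc]
          exact ha _ (Ideal.mul_mem_right c _ hj) }
    have hle : socle S ≤ T := by
      refine sSup_le fun I hI y hy => ?_
      by_cases h0 : y = 0
      · rw [h0]
        exact zero_mem _
      have hI' : IsSimpleModule S I := hI
      rw [eq_span_of_isSimpleModule hI' hy h0] at hI'
      exact jacobson_mul_of_isSimpleModule hI'
    exact hle hx j hj
  · intro hx
    by_cases h0 : x = 0
    · rw [h0]
      exact zero_mem _
    · exact mem_socle_of_isSimpleModule (isSimpleModule_span_of_jacobson_mul h0 hx)

theorem isNilpotent_of_mem_jacobson {j : S} (hj : j ∈ Ring.jacobson S) : IsNilpotent j := by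
  have key : ∀ m n : ℕ, m < n → j ^ m = j ^ n → IsNilpotent j := by
    intro m n hmn h
    obtain ⟨k, rfl⟩ := Nat.exists_eq_add_of_lt hmn
    refine ⟨m, ?_⟩
    have hu := isUnit_one_sub (Ideal.mul_mem_left (Ring.jacobson S) (j ^ k) hj)
    refine (hu.mul_left_eq_zero).1 ?_
    rw [mul_sub, mul_one, ← pow_succ, ← pow_add, ← add_assoc, ← h, sub_self]
  obtain ⟨m, n, hne, h⟩ := Finite.exists_ne_map_eq_of_infinite fun n : ℕ => j ^ n
  rcases lt_or_gt_of_ne hne with hlt | hlt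
  · exact key m n hlt h
  · exact key n m hlt h.symm

/-- The annihilator of x is the radical, so Sx already has |S/rad| = |soc| elements. -/
theorem socle_eq_span (hS : Nat.card (socle S) = Nat.card (S ⧸ Ring.jacobson S)) {x : S}
    (hx : x ∈ socle S) (h0 : x ≠ 0) : socle S = Ideal.span {x} := by
  have hle : (Ideal.span {x} : Set S) ⊆ socle S :=
    (Ideal.span_singleton_le_iff_mem (socle S)).2 hx
  have hc := card_span_of_jacobson_mul h0 ((mem_socle_iff_jacobson_mul x).1 hx)
  have := Set.eq_of_subset_of_ncard_le hle (by
    rw [← Nat.card_coe_set_eq, ← Nat.card_coe_set_eq]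
    exact (hS.trans hc.symm).le) (Set.toFinite _)
  exact SetLike.coe_injective this.symm

theorem exists_mem_socle_ne_zero (hS : Nat.card (socle S) = Nat.card (S ⧸ Ring.jacobson S)) :
    ∃ x ∈ socle S, x ≠ 0 := by
  have : 1 < Nat.card (socle S) := hS ▸ one_lt_card_quotient_jacobson
  refine Submodule.exists_mem_ne_zero_of_ne_bot fun h => ?_
  rw [h] at this
  simp at this

theorem socle_le_span (hS : Nat.card (socle S) = Nat.card (S ⧸ Ring.jacobson S)) {y : S}
    (hy : y ≠ 0) : socle S ≤ Ideal.span {y} := by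
  rcases IsAtomic.eq_bot_or_exists_atom_le (Ideal.span {y}) with h | ⟨a, ha, hay⟩
  · exact absurd (Ideal.span_singleton_eq_bot.1 h) hy
  · obtain ⟨z, hz, hz0⟩ := Submodule.exists_mem_ne_zero_of_ne_bot ha.1
    have has : IsSimpleModule S a := isSimpleModule_iff_isAtom.2 ha
    have hspan := eq_span_of_isSimpleModule has hz hz0
    rw [socle_eq_span hS (mem_socle_of_isSimpleModule (hspan ▸ has)) hz0, ← hspan]
    exact hay

theorem mul_mem_socle {x : S} (hx : x ∈ socle S) (s : S) : x * s ∈ socle S := by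
  rw [mem_socle_iff_jacobson_mul] at hx ⊢
  intro j hj
  rw [← mul_assoc, hx j hj, zero_mul]

/-- The side on which annihilation is not automatic. If xj ≠ 0, it generates the socle, so x =
r(xj); iterating gives x = r^k x j^k, which is 0 for large k since j is nilpotent. -/
theorem socle_mul_jacobson (hS : Nat.card (socle S) = Nat.card (S ⧸ Ring.jacobson S)) {x : S}
    (hx : x ∈ socle S) {j : S} (hj : j ∈ Ring.jacobson S) : x * j = 0 := by
  by_contra h0
  rw [socle_eq_span hS (mul_mem_socle hx j) h0] at hx
  obtain ⟨r, hr⟩ := Ideal.mem_span_singleton'.1 hx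
  have key : ∀ k : ℕ, r ^ k * x * j ^ k = x := by
    intro k
    induction k with
    | zero => simp
    | succ k ih =>
      rw [pow_succ r, pow_succ' j]
      calc r ^ k * r * x * (j * j ^ k) = r ^ k * (r * (x * j)) * j ^ k := by
            simp only [mul_assoc]
        _ = x := by rw [hr, ih]
  obtain ⟨k, hk⟩ := isNilpotent_of_mem_jacobson hj
  have := key k
  rw [hk, mul_zero] at this
  exact h0 (by rw [← this, zero_mul])

end

/-! ### Homogeneous weight -/

open scoped Classical in
/-- The local factor of `1 - ω`, where `ω` is the homogeneous weight. -/
noncomputable def socleFactor (S : Type*) [Ring S] (x : S) : ℚ :=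
  if x = 0 then 1 else if x ∈ socle S then -((Nat.card (socle S) : ℚ) - 1)⁻¹ else 0

theorem socleFactor_zero (S : Type*) [Ring S] : socleFactor S 0 = 1 := if_pos rfl

theorem socleFactor_congr {S : Type*} [Ring S] {x y : S}
    (h : Ideal.span {x} = (Ideal.span {y} : Ideal S)) : socleFactor S x = socleFactor S y := by
  have h0 : x = 0 ↔ y = 0 := by
    rw [← Ideal.span_singleton_eq_bot, h, Ideal.span_singleton_eq_bot]
  have hs : x ∈ socle S ↔ y ∈ socle S := by
    rw [← Ideal.span_singleton_le_iff_mem, h, Ideal.span_singleton_le_iff_mem]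
  classical
  exact if_congr h0 rfl (if_congr hs rfl rfl)

open scoped Classical in
theorem sum_socleFactor_span {S : Type*} [Ring S] [Fintype S] [IsLocalRing S]
    (hS : Nat.card (socle S) = Nat.card (S ⧸ Ring.jacobson S)) {x : S} (h0 : x ≠ 0) :
    (∑ y, if y ∈ (Ideal.span {x} : Ideal S) then socleFactor S y else 0) = 0 := by
  have hle := socle_le_span hS h0
  -- With q = |soc|, the value 1 at 0 is split as -1/(q-1) + q/(q-1), so the total is -q/(q-1) +
  -- q/(q-1).
  have h1 : ∀ y, (if y ∈ (Ideal.span {x} : Ideal S) then socleFactor S y else 0) =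
      (if y ∈ socle S then -((Nat.card (socle S) : ℚ) - 1)⁻¹ else 0) +
        if y = 0 then 1 + ((Nat.card (socle S) : ℚ) - 1)⁻¹ else 0 := by
    intro y
    by_cases hy : y = 0
    · subst hy
      simp [socleFactor_zero]
    · by_cases hs : y ∈ socle S
      · simp [socleFactor, hy, hs, hle hs]
      · simp [socleFactor, hy, hs]
  have hc : (Finset.card {y | y ∈ socle S}) = Nat.card (socle S) := by
    rw [Nat.card_eq_fintype_card, Fintype.card_subtype]
  have hq : 1 < Nat.card (socle S) := hS ▸ one_lt_card_quotient_jacobson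
  have hq' : (Nat.card (socle S) : ℚ) - 1 ≠ 0 := by
    have : (1 : ℚ) < Nat.card (socle S) := by exact_mod_cast hq
    linarith
  rw [Finset.sum_congr rfl fun y _ => h1 y, Finset.sum_add_distrib, ← Finset.sum_filter,
    Finset.sum_const, hc, Finset.sum_ite_eq', if_pos (Finset.mem_univ _), nsmul_eq_mul]
  field_simp
  ring

theorem mem_span_singleton_pi {ι : Type*} {S : ι → Type*} [∀ i, Ring (S i)] (x y : ∀ i, S i) :
    y ∈ (Ideal.span {x} : Ideal (∀ i, S i)) ↔ ∀ i, y i ∈ (Ideal.span {x i} : Ideal (S i)) := by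
  simp only [Ideal.mem_span_singleton']
  constructor
  · rintro ⟨a, rfl⟩ i
    exact ⟨a i, rfl⟩
  · intro h
    choose a ha using h
    exact ⟨a, funext ha⟩

theorem span_singleton_pi_congr {ι : Type*} {S : ι → Type*} [∀ i, Ring (S i)] {x y : ∀ i, S i}
    (h : Ideal.span {x} = (Ideal.span {y} : Ideal (∀ i, S i))) (i : ι) :
    Ideal.span {x i} = (Ideal.span {y i} : Ideal (S i)) := by
  refine le_antisymm ?_ ?_ <;> rw [Ideal.span_singleton_le_iff_mem]
  · exact (mem_span_singleton_pi y x).1 (h ▸ Ideal.mem_span_singleton_self x) i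
  · exact (mem_span_singleton_pi x y).1 (h ▸ Ideal.mem_span_singleton_self y) i

theorem homWeight_pi_pi {ι : Type*} [Fintype ι] {κ : ι → Type*} [∀ i, Fintype (κ i)]
    {R : ∀ i, κ i → Type*} [∀ i j, Ring (R i j)] [∀ i j, Finite (R i j)]
    [∀ i j, IsLocalRing (R i j)]
    (hR : ∀ i j, Nat.card (socle (R i j)) = Nat.card (R i j ⧸ Ring.jacobson (R i j)))
    (x : ∀ i j, R i j) :
    homWeight (∀ i j, R i j) x = 1 - ∏ i, ∏ j, socleFactor (R i j) (x i j) := by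
  classical
  have := fun i j => Fintype.ofFinite (R i j)
  suffices h : IsHomogeneousWeight 1
      (fun x : ∀ i j, R i j => 1 - ∏ i, ∏ j, socleFactor (R i j) (x i j)) from
    congrFun ((existsUnique_isHomogeneousWeight (∀ i j, R i j) 1).unique
      (homWeight_spec (∀ i j, R i j)) h) x
  refine ⟨?_, ?_, ?_⟩
  · simp [socleFactor_zero]
  · intro x y h
    refine congrArg (1 - ·) (Finset.prod_congr rfl fun i _ => Finset.prod_congr rfl fun j _ => ?_)
    exact socleFactor_congr (span_singleton_pi_congr (span_singleton_pi_congr h i) j)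
  · intro x hx
    obtain ⟨i, hi⟩ := Function.ne_iff.1 hx
    obtain ⟨j, hj⟩ := Function.ne_iff.1 hi
    -- A principal left ideal of the product is the product of those of the coordinates, so the sum
    -- factors, and one nonzero coordinate of `x` makes it vanish.
    have hprod : (∏ i, ∏ j, ∑ y, if y ∈ (Ideal.span {x i j} : Ideal (R i j))
        then socleFactor (R i j) y else 0) = 0 :=
      Finset.prod_eq_zero (Finset.mem_univ i) (Finset.prod_eq_zero (Finset.mem_univ j)
        (sum_socleFactor_span (hR i j) hj))
    simp only [Fintype.prod_sum, Finset.prod_ite_zero, Finset.mem_univ, true_imp_iff] at hprod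
    rw [finsum_mem_def, finsum_eq_sum_of_fintype]
    have h1 : ∀ y : ∀ i j, R i j, Set.indicator (Ideal.span {x} : Set (∀ i j, R i j))
        (fun y => 1 - ∏ i, ∏ j, socleFactor (R i j) (y i j)) y =
        (if y ∈ Ideal.span {x} then 1 else 0) -
          if ∀ i j, y i j ∈ (Ideal.span {x i j} : Ideal (R i j)) then
            ∏ i, ∏ j, socleFactor (R i j) (y i j) else 0 := by
      intro y
      have hy : (∀ i j, y i j ∈ (Ideal.span {x i j} : Ideal (R i j))) ↔ y ∈ Ideal.span {x} := by
        simp only [mem_span_singleton_pi]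
      rw [Set.indicator_apply]
      simp only [hy, SetLike.mem_coe]
      split_ifs <;> simp
    rw [Finset.sum_congr rfl fun y _ => h1 y, Finset.sum_sub_distrib, hprod, sub_zero, one_mul,
      Finset.sum_boole, Nat.card_eq_fintype_card, Fintype.card_subtype]

theorem hammingSoclePartition_eq {t : ℕ} {n : Fin t → ℕ} (R : ∀ i : Fin t, Fin (n i) → Type*)
    [∀ i j, Ring (R i j)] : hammingSoclePartition R =
      extendedHamming fun i j => (socle (R i j)).toAddSubgroup := by
  have h : (socle (∀ i j, R i j) : Set (∀ i j, R i j)) =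
      {x | ∀ i j, x i j ∈ (socle (R i j)).toAddSubgroup} := by
    ext x
    simp only [SetLike.mem_coe, mem_socle_pi, Set.mem_ofPred_eq, Submodule.mem_toAddSubgroup]
  exact congrArg (fun T => extendPartition T (Setoid.comap Subtype.val
    (prodPartition fun i => hammingPartition (R i)))) h

/-! ### Separating lists and the homogeneous partition -/

theorem IsSeparating.eq_of_prod_eq {t : ℕ} {q n : Fin t → ℕ} (hsep : IsSeparating q n)
    (hq : ∀ i, 1 < q i) {m l : Fin t → ℕ} (hm : ∀ i, m i ≤ n i) (hl : ∀ i, l i ≤ n i)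
    (h : ∏ i, (-((q i : ℚ) - 1)⁻¹) ^ m i = ∏ i, (-((q i : ℚ) - 1)⁻¹) ^ l i) : m = l := by
  have key : ∀ k : Fin t → ℕ, ∏ i, (-((q i : ℚ) - 1)⁻¹) ^ k i =
      (-1) ^ (∑ i, k i) * (∏ i, ((q i : ℚ) - 1) ^ k i)⁻¹ := by
    intro k
    rw [← Finset.prod_pow_eq_pow_sum, ← Finset.prod_inv_distrib, ← Finset.prod_mul_distrib]
    refine Finset.prod_congr rfl fun i _ => ?_
    rw [neg_pow, inv_pow]
  have hpos : ∀ k : Fin t → ℕ, 0 < ∏ i, ((q i : ℚ) - 1) ^ k i := by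
    intro k
    refine Finset.prod_pos fun i _ => pow_pos ?_ _
    have : (1 : ℚ) < q i := by exact_mod_cast hq i
    linarith
  rw [key, key] at h
  -- Absolute values give equality of the products of powers of q_i - 1; cancelling them leaves
  -- equality of signs, that is, of parities.
  have habs := congrArg abs h
  simp only [abs_mul, abs_pow, abs_neg, abs_one, one_pow, one_mul, abs_inv,
    abs_of_pos (hpos _)] at habs
  have heq := inv_injective habs
  rw [heq] at h
  have hsign := mul_right_cancel₀ (inv_ne_zero (hpos l).ne') h
  by_contra hne
  rcases hsep m l hm hl hne with h1 | h1
  · exact h1 (by exact_mod_cast heq)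
  · rw [neg_one_pow_eq_pow_mod_two, neg_one_pow_eq_pow_mod_two (n := ∑ i, l i)] at hsign
    apply h1
    unfold Nat.ModEq
    rcases Nat.mod_two_eq_zero_or_one (∑ i, m i) with h2 | h2 <;>
      rcases Nat.mod_two_eq_zero_or_one (∑ i, l i) with h3 | h3 <;>
      rw [h2, h3] at hsign ⊢ <;> norm_num at hsign

theorem prod_socleFactor_of_mem {n : ℕ} {S : Fin n → Type*} [∀ j, Ring (S j)] {q : ℕ}
    (hq : ∀ j, Nat.card (socle (S j)) = q) {x : ∀ j, S j} (hx : ∀ j, x j ∈ socle (S j)) :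
    ∏ j, socleFactor (S j) (x j) = (-((q : ℚ) - 1)⁻¹) ^ wt x := by
  classical
  rw [wt_eq_card, ← Finset.prod_const, Finset.prod_filter]
  refine Finset.prod_congr rfl fun j _ => ?_
  by_cases h : x j = 0
  · simp [h, socleFactor_zero]
  · simp [socleFactor, h, hx, hq]

section
variable {t : ℕ} {n : Fin t → ℕ} {q : Fin t → ℕ} {R : ∀ i : Fin t, Fin (n i) → Type*}
  [∀ i j, Ring (R i j)] [∀ i j, Finite (R i j)] [∀ i j, IsLocalRing (R i j)]

theorem homPartition_eq (hn : ∀ i, 0 < n i)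
    (hrad : ∀ i j, Nat.card (R i j ⧸ Ring.jacobson (R i j)) = q i)
    (hsoc : ∀ i j, Nat.card (socle (R i j)) = q i) (hsep : IsSeparating q n) :
    homPartition (∀ i j, R i j) = hammingSoclePartition R := by
  classical
  -- `hn` supplies a factor whose residue ring is nontrivial.
  have hq : ∀ i, 1 < q i := fun i => hrad i ⟨0, hn i⟩ ▸ one_lt_card_quotient_jacobson
  have hS : ∀ i j, Nat.card (socle (R i j)) = Nat.card (R i j ⧸ Ring.jacobson (R i j)) :=
    fun i j => (hsoc i j).trans (hrad i j).symm
  have hmem : ∀ x : ∀ i j, R i j, (∀ i j, x i j ∈ socle (R i j)) →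
      ∏ i, ∏ j, socleFactor (R i j) (x i j) = ∏ i, (-((q i : ℚ) - 1)⁻¹) ^ wt (x i) :=
    fun x hx => Finset.prod_congr rfl fun i _ => prod_socleFactor_of_mem (hsoc i) (hx i)
  have hnot : ∀ x : ∀ i j, R i j, (¬ ∀ i j, x i j ∈ socle (R i j)) →
      ∏ i, ∏ j, socleFactor (R i j) (x i j) = 0 := by
    intro x hx
    push Not at hx
    obtain ⟨i, j, hij⟩ := hx
    refine Finset.prod_eq_zero (Finset.mem_univ i) (Finset.prod_eq_zero (Finset.mem_univ j) ?_)
    have h0 : x i j ≠ 0 := fun h => hij (h ▸ zero_mem _)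
    simp [socleFactor, hij, h0]
  have hne : ∀ k : Fin t → ℕ, ∏ i, (-((q i : ℚ) - 1)⁻¹) ^ k i ≠ 0 := by
    intro k
    refine Finset.prod_ne_zero_iff.2 fun i _ => pow_ne_zero _ (neg_ne_zero.2 (inv_ne_zero ?_))
    have : (1 : ℚ) < q i := by exact_mod_cast hq i
    linarith
  have hwt : ∀ (x : ∀ i j, R i j) i, wt (x i) ≤ n i := by
    intro x i
    rw [wt_eq_card]
    exact (Finset.card_le_univ _).trans (Fintype.card_fin _).le
  rw [hammingSoclePartition_eq]
  ext x y
  rw [extendedHamming_iff, homPartition, Setoid.ker_def, homWeight_pi_pi hS, homWeight_pi_pi hS,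
    sub_right_inj]
  simp only [Submodule.mem_toAddSubgroup]
  by_cases hx : ∀ i j, x i j ∈ socle (R i j) <;> by_cases hy : ∀ i j, y i j ∈ socle (R i j)
  · rw [hmem x hx, hmem y hy]
    constructor
    · intro h
      exact Or.inr ⟨hx, hy, congrFun (hsep.eq_of_prod_eq hq (hwt x) (hwt y) h)⟩
    · rintro (h | h)
      · exact absurd hx h.1
      · simp only [h.2.2]
  · rw [hmem x hx, hnot y hy]
    exact iff_of_false (hne _) (by tauto)
  · rw [hnot x hx, hmem y hy]
    exact iff_of_false (hne _).symm (by tauto)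
  · rw [hnot x hx, hnot y hy]
    exact iff_of_true rfl (Or.inl ⟨hx, hy⟩)

end

/-! ### Generating characters -/

theorem IsGenerating.isDualPairing {R : Type*} [Ring R] [Finite R] {χ : AddChar R ℂ}
    (hχ : IsGenerating χ) : IsDualPairing fun w v => χ (w * v) := by
  have h1 : ∀ x : R, leftMap χ x = leftMap χ 0 ↔ ∀ w, χ (w * x) = 1 := by
    intro x
    rw [AddChar.ext_iff]
    refine forall_congr' fun w => ?_
    change χ (w * x) = χ (w * 0) ↔ _
    rw [mul_zero, AddChar.map_zero_eq_one]
  have h2 : ∀ x : R, rightMap χ x = rightMap χ 0 ↔ ∀ w, χ (x * w) = 1 := by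
    intro x
    rw [AddChar.ext_iff]
    refine forall_congr' fun w => ?_
    change χ (x * w) = χ (0 * w) ↔ _
    rw [zero_mul, AddChar.map_zero_eq_one]
  exact ⟨fun h => by simp, fun g => by simp, fun g g' h => by rw [add_mul, AddChar.map_add_eq_mul],
    fun g h h' => by rw [mul_add, AddChar.map_add_eq_mul],
    fun g hg => hχ.2.1 ((h2 g).2 hg), fun h hh => hχ.1.1 ((h1 h).2 hh)⟩

theorem card_addChar (R : Type*) [AddCommGroup R] [Finite R] :
    Nat.card (AddChar R ℂ) = Nat.card R := by
  have := Fintype.ofFinite R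
  rw [Nat.card_eq_fintype_card, Nat.card_eq_fintype_card, AddChar.card_eq]

theorem leftMap_bijective {R : Type*} [Ring R] [Finite R] {χ : AddChar R ℂ}
    (h : ∀ v, (∀ w, χ (w * v) = 1) → v = 0) : Function.Bijective (leftMap χ) := by
  refine (Nat.bijective_iff_injective_and_card _).2 ⟨fun v v' hv => ?_, (card_addChar R).symm⟩
  refine sub_eq_zero.1 (h _ fun w => ?_)
  have hw : χ (w * v) = χ (w * v') := DFunLike.congr_fun hv w
  rw [mul_sub, AddChar.map_sub_eq_div, hw, div_self (χ.val_isUnit _).ne_zero]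

theorem rightMap_bijective {R : Type*} [Ring R] [Finite R] {χ : AddChar R ℂ}
    (h : ∀ v, (∀ w, χ (v * w) = 1) → v = 0) : Function.Bijective (rightMap χ) := by
  refine (Nat.bijective_iff_injective_and_card _).2 ⟨fun v v' hv => ?_, (card_addChar R).symm⟩
  refine sub_eq_zero.1 (h _ fun w => ?_)
  have hw : χ (v * w) = χ (v' * w) := DFunLike.congr_fun hv w
  rw [sub_mul, AddChar.map_sub_eq_div, hw, div_self (χ.val_isUnit _).ne_zero]

theorem IsDualPairing.isGenerating {R : Type*} [Ring R] [Finite R] {χ : AddChar R ℂ}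
    (h : IsDualPairing fun w v => χ (w * v)) : IsGenerating χ :=
  ⟨leftMap_bijective h.nondeg_right, rightMap_bijective h.nondeg_left⟩

/-- One side suffices: every character has the form x ↦ χ(xw), so if χ(vw) = 1 for all w, all
characters are trivial at v and v = 0. -/
theorem isGenerating_of_leftMap {R : Type*} [Ring R] [Finite R] {χ : AddChar R ℂ}
    (h : ∀ v, (∀ w, χ (w * v) = 1) → v = 0) : IsGenerating χ := by
  have hl := leftMap_bijective h
  refine ⟨hl, rightMap_bijective fun v hv => ?_⟩
  by_contra h0
  obtain ⟨ψ, hψ⟩ := AddChar.exists_apply_ne_zero.2 h0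
  obtain ⟨w, rfl⟩ := hl.2 ψ
  exact hψ (hv w)

/-- Any χ nontrivial at some socle element x works: every nonzero v has x among its left multiples.
-/
theorem exists_isGenerating {S : Type*} [Ring S] [Finite S] [IsLocalRing S]
    (hS : Nat.card (socle S) = Nat.card (S ⧸ Ring.jacobson S)) :
    ∃ χ : AddChar S ℂ, IsGenerating χ := by
  obtain ⟨x, hx, h0⟩ := exists_mem_socle_ne_zero hS
  obtain ⟨χ, hχ⟩ := AddChar.exists_apply_ne_zero.2 h0
  refine ⟨χ, isGenerating_of_leftMap fun v hv => ?_⟩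
  by_contra hv0
  obtain ⟨r, rfl⟩ := Ideal.mem_span_singleton'.1 (socle_le_span hS hv0 hx)
  exact hχ (hv r)

theorem exists_isGenerating_pi {ι : Type*} [Finite ι] {S : ι → Type*} [∀ i, Ring (S i)]
    [∀ i, Finite (S i)] (h : ∀ i, ∃ χ : AddChar (S i) ℂ, IsGenerating χ) :
    ∃ χ : AddChar (∀ i, S i) ℂ, IsGenerating χ := by
  have := Fintype.ofFinite ι
  choose χ hχ using h
  exact ⟨⟨fun x => ∏ i, χ i (x i), by simp,
    fun x y => by simp [AddChar.map_add_eq_mul, Finset.prod_mul_distrib]⟩,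
    (IsDualPairing.pi fun i => (hχ i).isDualPairing).isGenerating⟩

/-- The restriction of a character of a product to a factor. -/
def restrictChar {ι : Type*} [DecidableEq ι] {S : ι → Type*} [∀ i, Ring (S i)]
    (χ : AddChar (∀ i, S i) ℂ) (i : ι) : AddChar (S i) ℂ :=
  χ.compAddMonoidHom (AddMonoidHom.single S i)

theorem apply_eq_prod_restrictChar {ι : Type*} [Fintype ι] [DecidableEq ι] {S : ι → Type*}
    [∀ i, Ring (S i)] (χ : AddChar (∀ i, S i) ℂ) (x : ∀ i, S i) :
    χ x = ∏ i, restrictChar χ i (x i) := by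
  conv_lhs => rw [← Finset.univ_sum_single x]
  exact map_prod χ.toMonoidHom _ _

theorem IsGenerating.restrictChar {ι : Type*} [DecidableEq ι] [Finite ι] {S : ι → Type*}
    [∀ i, Ring (S i)] [∀ i, Finite (S i)] {χ : AddChar (∀ i, S i) ℂ} (hχ : IsGenerating χ)
    (i : ι) : IsGenerating (restrictChar χ i) := by
  refine isGenerating_of_leftMap fun v hv => ?_
  have h := hχ.isDualPairing.nondeg_right (Pi.single i v) fun w => by
    rw [← Pi.single_mul_right]
    exact hv (w i)
  simpa using h

/-- Under the bijection `leftMap χ` from R to its character group, the dual partition becomes the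
left χ-dual and evaluation at a becomes u ↦ χ(au). So the bidual can be computed inside R. -/
theorem isReflexive_of_isGenerating {R : Type*} [Ring R] [Finite R] {χ : AddChar R ℂ}
    (hχ : IsGenerating χ) {P : Setoid R}
    (hP : kernelDual (fun v w => χ (w * v)) (leftDual χ P) = P) : IsReflexive P := by
  have key : ∀ v a, ∑ᶠ ψ ∈ {ψ | dualPartition P ψ (leftMap χ v)},
      AddChar.doubleDualEmb a ψ = ∑ᶠ u ∈ {u | leftDual χ P u v}, χ (a * u) := by
    intro v a
    refine (finsum_mem_eq_of_bijOn (leftMap χ) ⟨fun u hu => hu, hχ.1.1.injOn, fun ψ hψ => ?_⟩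
      fun u _ => rfl).symm
    obtain ⟨u, rfl⟩ := hχ.1.2 ψ
    exact ⟨u, hψ, rfl⟩
  unfold IsReflexive
  conv_rhs => rw [← hP]
  ext a b
  constructor
  · rintro h B ⟨v, rfl⟩
    have := h _ ⟨leftMap χ v, rfl⟩
    rwa [key, key] at this
  · rintro h B ⟨ψ, rfl⟩
    obtain ⟨v, rfl⟩ := hχ.1.2 ψ
    rw [key, key]
    exact h _ ⟨v, rfl⟩

/-! ### Duals of the partition `H'` -/

theorem hammingSoclePartition_of_isSemisimpleRing {t : ℕ} {n : Fin t → ℕ}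
    {R : ∀ i : Fin t, Fin (n i) → Type*} [∀ i j, Ring (R i j)]
    (h : IsSemisimpleRing (∀ i j, R i j)) :
    hammingSoclePartition R = prodPartition fun i => hammingPartition (R i) := by
  have hmem : ∀ (x : ∀ i j, R i j) i j, x i j ∈ (socle (R i j)).toAddSubgroup := by
    intro x
    have hx : x ∈ socle (∀ i j, R i j) := (socle_eq_top_iff _).2 h ▸ Submodule.mem_top
    exact fun i j => (mem_socle_pi _).1 ((mem_socle_pi x).1 hx i) j
  rw [hammingSoclePartition_eq]
  ext x y
  rw [extendedHamming_iff]
  constructor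
  · rintro (h | h)
    · exact absurd (hmem x) h.1
    · exact h.2.2
  · intro h
    exact Or.inr ⟨hmem x, hmem y, h⟩

section
variable {t : ℕ} {n : Fin t → ℕ} {q : Fin t → ℕ} {R : ∀ i : Fin t, Fin (n i) → Type*}
  [∀ i j, Ring (R i j)] [∀ i j, Finite (R i j)] [∀ i j, IsLocalRing (R i j)]

theorem dual_hammingSoclePartition
    (hrad : ∀ i j, Nat.card (R i j ⧸ Ring.jacobson (R i j)) = q i)
    (hsoc : ∀ i j, Nat.card (socle (R i j)) = q i) {χ : AddChar (∀ i j, R i j) ℂ}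
    (hχ : IsGenerating χ) :
    leftDual χ (hammingSoclePartition R) =
        quotientHamming (fun i j => (Ring.jacobson (R i j)).toAddSubgroup) ∧
      rightDual χ (hammingSoclePartition R) =
        quotientHamming (fun i j => (Ring.jacobson (R i j)).toAddSubgroup) ∧
      IsReflexive (hammingSoclePartition R) := by
  have hS : ∀ i j, Nat.card (socle (R i j)) = Nat.card (R i j ⧸ Ring.jacobson (R i j)) :=
    fun i j => (hsoc i j).trans (hrad i j).symm
  have hcard : ∀ i j, Nat.card (socle (R i j)).toAddSubgroup *
      Nat.card (Ring.jacobson (R i j)).toAddSubgroup = Nat.card (R i j) := by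
    intro i j
    have h := card_mul_card_jacobson (R i j)
    rw [← hS] at h
    exact h
  have hχ' := fun i j => ((hχ.restrictChar i).restrictChar j).isDualPairing
  have hprod : ∀ w v : ∀ i j, R i j, χ (w * v) =
      ∏ i, ∏ j, restrictChar (restrictChar χ i) j (w i j * v i j) := by
    intro w v
    rw [apply_eq_prod_restrictChar]
    exact Finset.prod_congr rfl fun i _ => apply_eq_prod_restrictChar _ _
  -- The left dual uses soc·rad = 0; the right dual below uses the flipped pairing and rad·soc = 0.
  have hl := kernelDual_extendedHamming (A := fun i j => (socle (R i j)).toAddSubgroup)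
    (B := fun i j => (Ring.jacobson (R i j)).toAddSubgroup) (q := q) hχ'
    (fun i j a ha b hb => by
      rw [socle_mul_jacobson (hS i j) ha hb, AddChar.map_zero_eq_one]) hcard hcard hsoc
  have hr := kernelDual_extendedHamming (A := fun i j => (socle (R i j)).toAddSubgroup)
    (B := fun i j => (Ring.jacobson (R i j)).toAddSubgroup) (q := q) (fun i j => (hχ' i j).flip)
    (fun i j a ha b hb => by
      rw [(mem_socle_iff_jacobson_mul a).1 ha b hb, AddChar.map_zero_eq_one]) hcard hcard hsoc
  simp only [← hprod] at hl hr
  rw [hammingSoclePartition_eq]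
  refine ⟨hl.1, hr.1, isReflexive_of_isGenerating hχ ?_⟩
  have h1 : leftDual χ (extendedHamming fun i j => (socle (R i j)).toAddSubgroup) = _ := hl.1
  rw [h1]
  exact hl.2

theorem quotientHamming_of_isSemisimpleRing
    (hS : ∀ i j, Nat.card (socle (R i j)) = Nat.card (R i j ⧸ Ring.jacobson (R i j)))
    (h : IsSemisimpleRing (∀ i j, R i j)) :
    quotientHamming (fun i j => (Ring.jacobson (R i j)).toAddSubgroup) =
      prodPartition fun i => hammingPartition (R i) := by
  classical
  have hmem : ∀ i j (s : R i j), s ∈ socle (R i j) := by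
    intro i j s
    have hx : (Pi.single i (Pi.single j s) : ∀ i j, R i j) ∈ socle (∀ i j, R i j) :=
      (socle_eq_top_iff _).2 h ▸ Submodule.mem_top
    simp only [mem_socle_pi] at hx
    simpa using hx i j
  -- Here 1 lies in the socle, and soc·rad = 0 kills s = 1·s.
  have hjac : ∀ i j (s : R i j), s ∈ (Ring.jacobson (R i j)).toAddSubgroup ↔ s = 0 := by
    intro i j s
    refine ⟨fun hs => ?_, fun hs => hs ▸ zero_mem _⟩
    rw [← one_mul s]
    exact socle_mul_jacobson (hS i j) (hmem i j 1) hs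
  ext v v'
  rw [quotientHamming_iff]
  simp only [hjac]
  have hwt : ∀ u : ∀ i j, R i j, u = 0 ↔ ∀ i, wt (u i) = 0 := by
    intro u
    simp only [wt, hammingNorm_eq_zero]
    exact funext_iff
  constructor
  · intro h i
    change wt (v i) = wt (v' i)
    rw [wt_eq_card, wt_eq_card]
    convert h.2 i
  · intro h
    have h' : ∀ i, wt (v i) = wt (v' i) := h
    refine ⟨by simp only [hwt, h'], fun i => ?_⟩
    have := h' i
    rw [wt_eq_card, wt_eq_card] at this
    convert this

end

end HomogPart

theorem mainTheorem3 {t : ℕ} {n : Fin t → ℕ} (q : Fin t → ℕ)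
    (R : ∀ i : Fin t, Fin (n i) → Type*) [∀ i j, Ring (R i j)] [∀ i j, Finite (R i j)]
    [∀ i j, IsLocalRing (R i j)]
    (hFrob : HomogPart.IsFrobenius (∀ i j, R i j))
    (hn : ∀ i, 0 < n i) (hq : Function.Injective q)
    (hrad : ∀ i j, Nat.card (R i j ⧸ Ring.jacobson (R i j)) = q i)
    (hsoc : ∀ i j, Nat.card (HomogPart.socle (R i j)) = q i)
    (hsep : HomogPart.IsSeparating q n) :
    -- the homogeneous partition is the partition `H'`
    HomogPart.homPartition (∀ i j, R i j) = HomogPart.hammingSoclePartition R ∧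
    -- it is reflexive
    HomogPart.IsReflexive (HomogPart.homPartition (∀ i j, R i j)) ∧
    -- generating characters exist, the dual `D` of `H'` depends neither on the side nor on the
    -- generating character, and it is the left and the right dual of the homogeneous partition
    (∃ χ : AddChar (∀ i j, R i j) ℂ, HomogPart.IsGenerating χ) ∧
    (∃ D : Setoid (∀ i j, R i j), ∀ χ : AddChar (∀ i j, R i j) ℂ, HomogPart.IsGenerating χ →
      HomogPart.leftDual χ (HomogPart.hammingSoclePartition R) = D ∧
      HomogPart.rightDual χ (HomogPart.hammingSoclePartition R) = D ∧
      HomogPart.leftDual χ (HomogPart.homPartition (∀ i j, R i j)) = D ∧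
      HomogPart.rightDual χ (HomogPart.homPartition (∀ i j, R i j)) = D) ∧
    -- the semisimple case
    (HomogPart.socle (∀ i j, R i j) = ⊤ ↔ IsSemisimpleRing (∀ i j, R i j)) ∧
    (IsSemisimpleRing (∀ i j, R i j) →
      HomogPart.homPartition (∀ i j, R i j) =
        HomogPart.prodPartition (fun i => HomogPart.hammingPartition (R i)) ∧
      ∀ χ : AddChar (∀ i j, R i j) ℂ, HomogPart.IsGenerating χ →
        HomogPart.leftDual χ (HomogPart.homPartition (∀ i j, R i j)) =
          HomogPart.homPartition (∀ i j, R i j) ∧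
        HomogPart.rightDual χ (HomogPart.homPartition (∀ i j, R i j)) =
          HomogPart.homPartition (∀ i j, R i j)) := by
  have hS : ∀ i j, Nat.card (HomogPart.socle (R i j)) =
      Nat.card (R i j ⧸ Ring.jacobson (R i j)) :=
    fun i j => (hsoc i j).trans (hrad i j).symm
  have hex : ∃ χ : AddChar (∀ i j, R i j) ℂ, HomogPart.IsGenerating χ :=
    HomogPart.exists_isGenerating_pi fun i => HomogPart.exists_isGenerating_pi fun j =>
      HomogPart.exists_isGenerating (hS i j)
  rw [HomogPart.homPartition_eq hn hrad hsoc hsep]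
  have hdual := fun (χ : AddChar (∀ i j, R i j) ℂ) (hχ : HomogPart.IsGenerating χ) =>
    HomogPart.dual_hammingSoclePartition hrad hsoc hχ
  -- The common dual, found by unification, is `quotientHamming` of the radicals, which does not
  -- involve χ.
  refine ⟨rfl, hex.elim fun χ hχ => (hdual χ hχ).2.2, hex, ⟨_, fun χ hχ =>
    ⟨(hdual χ hχ).1, (hdual χ hχ).2.1, (hdual χ hχ).1, (hdual χ hχ).2.1⟩⟩,
    HomogPart.socle_eq_top_iff _, fun h => ?_⟩
  have h1 := HomogPart.hammingSoclePartition_of_isSemisimpleRing h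
  have h2 := h1.trans (HomogPart.quotientHamming_of_isSemisimpleRing hS h).symm
  exact ⟨h1, fun χ hχ => ⟨(hdual χ hχ).1.trans h2.symm, (hdual χ hχ).2.1.trans h2.symm⟩⟩
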